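/- **Definitions.** A map $f:X\to Y$ between metric spaces is *$K$-bilipschitz* ($K>0$) if $\frac1K d(x,y)\le d(f(x),f(y))\le K\,d(x,y)$ for all $x,y\in X$. A *clone structure* on a metric space $C$ consists of - a partition of $C$ into finitely many nonempty clopen sets $A_1,\dots,A_n$ (*models*); - a partition of $C$ into finitely many nonempty clopen sets $E_1,\dots,E_m$ (*level-1 clones*), each contained in some model, such that every model contains at least two of them; - for each $i$, a surjective similarity $\tau_i:E_i\to A_{j}$ onto some model $A_j$, with scale factor $k_i>1$, i.e. $d(\tau_i(x),\tau_i(y))=k_i\,d(x,y)$ for all $x,y\in E_i$. The index $j$ is the *type* of $E_i$. For $d>0$ its matrix $M_d$ is the $n\times n$ matrix whose $(i,j)$ entry is $\sum k_e^{-d}$, the sum being over the level-1 clones $E_e$ of type $i$ contained in $A_j$. The matrix is *irreducible* if some power $(M_d)^k$, $k\ge 1$, has only positive entries. A *multi-model Cantor set* is a nonempty, compact, totally disconnected, perfect metric space which has a clone structure whose matrices $M_d$, $d>0$, are irreducible. **Theorem.** Let $C$ and $C'$ be multi-model Cantor sets, and let $f:C\to C'$ be a $K$-bilipschitz map whose image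 $f(C)$ is a clopen subset of $C'$. Then $C$ and $C'$ have the same, finite, Hausdorff dimension $\delta$. Moreover there is a nonempty clopen set $A\subseteq C$ such that the restriction $f|_A$ is measure linear with respect to the $\delta$-dimensional Hausdorff measure $\mathcal H_\delta$ (it has constant Radon–Nikodym derivative): there is a constant $c\in(0,\infty)$ with $$\mathcal H_\delta(f(B))=c\,\mathcal H_\delta(B)\qquad\text{for every Borel set } B\subseteq A.$$ -/

import Mathlib

open Set MeasureTheory
open scoped NNReal ENNReal

/-- A clone structure on a metric space `C`: a partition of `C` into nonempty clopen *models*,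
a finer partition into nonempty clopen *level-1 clones*, at least two of them in each model, and a
map `τ : C → C` (the union of the clone maps) which restricts on every level-1 clone to an
expanding similarity onto some model. -/
structure CloneStructure (C : Type*) [MetricSpace C] where
  /-- number of models -/
  n : ℕ
  /-- number of level-1 clones -/
  m : ℕ
  model : Fin n → Set C
  isClopen_model : ∀ j, IsClopen (model j)
  nonempty_model : ∀ j, (model j).Nonempty
  disjoint_model : Pairwise fun j k => Disjoint (model j) (model k)
  iUnion_model : ⋃ j, model j = univ
  clone : Fin m → Set C
  isClopen_clone : ∀ i, IsClopen (clone i)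
  nonempty_clone : ∀ i, (clone i).Nonempty
  disjoint_clone : Pairwise fun i k => Disjoint (clone i) (clone k)
  iUnion_clone : ⋃ i, clone i = univ
  /-- the index of the model which contains a given level-1 clone -/
  loc : Fin m → Fin n
  clone_subset : ∀ i, clone i ⊆ model (loc i)
  two_le_card : ∀ j, 2 ≤ (Finset.univ.filter fun i => loc i = j).card
  /-- the type of a level-1 clone: the index of the model onto which it is mapped -/
  type : Fin m → Fin n
  /-- the scale factor of the clone map of a level-1 clone -/
  scale : Fin m → ℝ
  one_lt_scale : ∀ i, 1 < scale i
  /-- the union of the clone maps -/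
  τ : C → C
  image_clone : ∀ i, τ '' clone i = model (type i)
  dist_τ : ∀ i, ∀ x ∈ clone i, ∀ y ∈ clone i, dist (τ x) (τ y) = scale i * dist x y

/-- The matrix `M_d` of a clone structure: the entry `(i, j)` is the sum of the `d`-th powers of
the inverse scale factors of the level-1 clones of type `i` contained in model `j`. -/
noncomputable def CloneStructure.matrix {C : Type*} [MetricSpace C] (S : CloneStructure C)
    (d : ℝ) : Matrix (Fin S.n) (Fin S.n) ℝ :=
  Matrix.of fun i j =>
    ∑ e ∈ Finset.univ.filter (fun e => S.type e = i ∧ S.loc e = j), ((S.scale e)⁻¹) ^ d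

/-- The matrices `M_d`, `d > 0`, are irreducible, in the sense that their entries are nonnegative
and all entries of some positive power are positive. -/
def CloneStructure.IsIrreducible {C : Type*} [MetricSpace C] (S : CloneStructure C) : Prop :=
  ∀ d : ℝ, 0 < d → (S.matrix d).IsPrimitive

/-- A multi-model Cantor set (with irreducible matrix): a metric space which is a Cantor set, i.e.
compact, totally disconnected, perfect and nonempty, and which has a clone structure with
irreducible matrix. -/
structure IsMultiModelCantorSet (C : Type*) [MetricSpace C] : Prop where
  compact : CompactSpace C
  totallyDisconnected : TotallyDisconnectedSpace C
  perfect : PerfectSpace C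
  nonempty : Nonempty C
  exists_cloneStructure : ∃ S : CloneStructure C, S.IsIrreducible

/-- `f` is `K`-bilipschitz. -/
def IsBilipschitz {X Y : Type*} [MetricSpace X] [MetricSpace Y] (K : ℝ) (f : X → Y) : Prop :=
  0 < K ∧ ∀ x y, (1 / K) * dist x y ≤ dist (f x) (f y) ∧ dist (f x) (f y) ≤ K * dist x y

/-- The restriction of `f` to `A` is measure linear with respect to `μ` and `ν`: it multiplies the
measure of all measurable subsets of `A` by one and the same positive finite constant. -/
def IsMeasureLinearOn {X Y : Type*} [MeasurableSpace X] [MeasurableSpace Y]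
    (μ : Measure X) (ν : Measure Y) (f : X → Y) (A : Set X) : Prop :=
  ∃ c : ℝ≥0, 0 < c ∧ ∀ B ⊆ A, MeasurableSet B → ν (f '' B) = c * μ B

/-! Itineraries under `τ` turn the space into a tree of cylinders. On a cylinder of level `p` the
iterate `τ^[p]` is a similarity of ratio `expansion p x` onto a model, so both the diameter of the
cylinder and its distance to its complement are controlled by the inverse of that ratio.

Perron–Frobenius theory supplies `δ > 0` and a positive row vector `v` with `v M_δ = v`. Giving each
cylinder the weight `expansion ^ (-δ)` times the entry of `v` at its image model is consistent under
subdivision. Covers by small cylinders then show that `H_δ` is finite, and a mass distribution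
argument shows that it is positive on every model. Hence every nonempty open set has dimension `δ`;
applying this to the clopen image of the bilipschitz map identifies the two dimensions.

For linearity, consider the density `H_δ(f(Z)) / H_δ(Z)` of cylinders `Z`. It is bounded, by the
bilipschitz condition. The image of a cylinder, magnified to unit size by an iterate of `τ'`, is a
union of cylinders of a fixed level `q`, so only finitely many shapes occur
(`exists_image_cyl_saturated`). Therefore, below some level, the density changes from a cylinder to
a child by one of finitely many factors (`exists_finite_ratio`). Choose a cylinder whose density is
so close to the supremum that no factor exceeding `1` is possible. The density of a cylinder is a
weighted average of those of its children, so all of them are equal, and inductively so on all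
descendants (`exists_restrict_cyl_eq`). -/

namespace CloneStructure

/-! ### Symbolic coding: cylinders and expansion factors -/

section Cylinders

variable {C : Type*} [MetricSpace C] (S : CloneStructure C)

/-- The index of the level-1 clone which contains a given point. -/
noncomputable def idx (x : C) : Fin S.m :=
  (mem_iUnion.1 (S.iUnion_clone.symm ▸ mem_univ x)).choose

lemma mem_clone_idx (x : C) : x ∈ S.clone (S.idx x) :=
  (mem_iUnion.1 (S.iUnion_clone.symm ▸ mem_univ x)).choose_spec

lemma mem_clone_iff {x : C} {e : Fin S.m} : x ∈ S.clone e ↔ S.idx x = e := by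
  refine ⟨fun h => ?_, fun h => h ▸ S.mem_clone_idx x⟩
  by_contra hne
  exact (disjoint_left.1 (S.disjoint_clone hne)) (S.mem_clone_idx x) h

/-- The index of the model which contains a given point. -/
noncomputable def modelIdx (x : C) : Fin S.n := S.loc (S.idx x)

lemma mem_model_iff {x : C} {j : Fin S.n} : x ∈ S.model j ↔ S.modelIdx x = j := by
  have hx : x ∈ S.model (S.modelIdx x) := S.clone_subset _ (S.mem_clone_idx x)
  refine ⟨fun h => ?_, fun h => h ▸ hx⟩
  by_contra hne
  exact (disjoint_left.1 (S.disjoint_model hne)) hx h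

lemma modelIdx_τ (x : C) : S.modelIdx (S.τ x) = S.type (S.idx x) := by
  rw [← S.mem_model_iff, ← S.image_clone]
  exact mem_image_of_mem _ (S.mem_clone_idx x)

lemma dist_τ_of_idx_eq {x y : C} (h : S.idx y = S.idx x) :
    dist (S.τ x) (S.τ y) = S.scale (S.idx x) * dist x y :=
  S.dist_τ _ x (S.mem_clone_idx x) y (S.mem_clone_iff.2 h)

lemma exists_idx_eq_τ_eq {e : Fin S.m} {y : C} (h : S.modelIdx y = S.type e) :
    ∃ x, S.idx x = e ∧ S.τ x = y := by
  rw [← S.mem_model_iff, ← S.image_clone] at h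
  obtain ⟨x, hx, rfl⟩ := h
  exact ⟨x, S.mem_clone_iff.1 hx, rfl⟩

lemma scale_pos (e : Fin S.m) : 0 < S.scale e := zero_lt_one.trans (S.one_lt_scale e)

/-- The cylinder (or clone) of level `p` which contains a given point; the cylinders of level `0`
are the models. -/
def cyl : ℕ → C → Set C
  | 0, x => {y | S.modelIdx y = S.modelIdx x}
  | p + 1, x => {y | S.idx y = S.idx x ∧ S.τ y ∈ cyl p (S.τ x)}

/-- The scale factor of the `p`-th iterate of `τ` on the cylinder of level `p` at `x`. -/
noncomputable def expansion : ℕ → C → ℝ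
  | 0, _ => 1
  | p + 1, x => S.scale (S.idx x) * expansion p (S.τ x)

lemma mem_cyl_zero {x y : C} : y ∈ S.cyl 0 x ↔ S.modelIdx y = S.modelIdx x := Iff.rfl

lemma mem_cyl_succ {p : ℕ} {x y : C} :
    y ∈ S.cyl (p + 1) x ↔ S.idx y = S.idx x ∧ S.τ y ∈ S.cyl p (S.τ x) := Iff.rfl

lemma expansion_succ (p : ℕ) (x : C) :
    S.expansion (p + 1) x = S.scale (S.idx x) * S.expansion p (S.τ x) := rfl

lemma cyl_zero (x : C) : S.cyl 0 x = S.model (S.modelIdx x) := by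
  ext y
  rw [mem_cyl_zero, mem_model_iff]

lemma self_mem_cyl (p : ℕ) (x : C) : x ∈ S.cyl p x := by
  induction p generalizing x with
  | zero => rfl
  | succ p ih => exact ⟨rfl, ih _⟩

lemma cyl_eq_of_mem {p : ℕ} {x y : C} (h : y ∈ S.cyl p x) : S.cyl p y = S.cyl p x := by
  induction p generalizing x y with
  | zero =>
    ext z
    rw [mem_cyl_zero, mem_cyl_zero, S.mem_cyl_zero.1 h]
  | succ p ih =>
    ext z
    rw [mem_cyl_succ, mem_cyl_succ, h.1, ih h.2]

lemma expansion_eq_of_mem {p : ℕ} {x y : C} (h : y ∈ S.cyl p x) :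
    S.expansion p y = S.expansion p x := by
  induction p generalizing x y with
  | zero => rfl
  | succ p ih => rw [expansion_succ, expansion_succ, h.1, ih h.2]

lemma modelIdx_iterate_of_mem {p : ℕ} {x y : C} (h : y ∈ S.cyl p x) :
    S.modelIdx (S.τ^[p] y) = S.modelIdx (S.τ^[p] x) := by
  induction p generalizing x y with
  | zero => exact h
  | succ p ih => exact ih h.2

lemma cyl_succ_subset (p : ℕ) (x : C) : S.cyl (p + 1) x ⊆ S.cyl p x := by
  induction p generalizing x with
  | zero =>
    intro y hy
    rw [mem_cyl_zero, modelIdx, hy.1, modelIdx]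
  | succ p ih => exact fun y hy => ⟨hy.1, ih _ hy.2⟩

lemma cyl_antitone (x : C) : Antitone fun p => S.cyl p x :=
  antitone_nat_of_succ_le fun p => S.cyl_succ_subset p x

lemma mem_cyl_add {p q : ℕ} {x y : C} :
    y ∈ S.cyl (p + q) x ↔ y ∈ S.cyl p x ∧ S.τ^[p] y ∈ S.cyl q (S.τ^[p] x) := by
  induction p generalizing x y with
  | zero =>
    rw [zero_add]
    exact ⟨fun h => ⟨S.cyl_antitone x (Nat.zero_le q) h, h⟩, fun h => h.2⟩
  | succ p ih =>
    rw [show p + 1 + q = p + q + 1 by omega, mem_cyl_succ, mem_cyl_succ, ih, and_assoc]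
    rfl

/-- Refines by the last letter of the itinerary instead of the first, as needed to pass from a
cylinder to its children. -/
lemma mem_cyl_succ' {p : ℕ} {x y : C} :
    y ∈ S.cyl (p + 1) x ↔ y ∈ S.cyl p x ∧ S.idx (S.τ^[p] y) = S.idx (S.τ^[p] x) := by
  refine ⟨fun h => ⟨S.cyl_succ_subset p x h, (S.mem_cyl_add.1 h).2.1⟩, fun h => ?_⟩
  refine S.mem_cyl_add.2 ⟨h.1, h.2, ?_⟩
  rw [mem_cyl_zero, modelIdx_τ, modelIdx_τ, h.2]

lemma expansion_add (p q : ℕ) (x : C) :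
    S.expansion (p + q) x = S.expansion p x * S.expansion q (S.τ^[p] x) := by
  induction p generalizing x with
  | zero => simp [expansion]
  | succ p ih =>
    rw [show p + 1 + q = p + q + 1 by omega, expansion_succ, expansion_succ, ih, mul_assoc]
    rfl

lemma expansion_succ' (p : ℕ) (x : C) :
    S.expansion (p + 1) x = S.expansion p x * S.scale (S.idx (S.τ^[p] x)) := by
  rw [expansion_add]
  simp [expansion]

lemma expansion_pos (p : ℕ) (x : C) : 0 < S.expansion p x := by
  induction p generalizing x with
  | zero => exact zero_lt_one
  | succ p ih => exact mul_pos (S.scale_pos _) (ih _)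

lemma expansion_lt_succ (p : ℕ) (x : C) : S.expansion p x < S.expansion (p + 1) x := by
  rw [expansion_succ']
  exact lt_mul_of_one_lt_right (S.expansion_pos p x) (S.one_lt_scale _)

lemma expansion_strictMono (x : C) : StrictMono fun p => S.expansion p x :=
  strictMono_nat_of_lt_succ fun p => S.expansion_lt_succ p x

lemma one_le_expansion (p : ℕ) (x : C) : 1 ≤ S.expansion p x :=
  (S.expansion_strictMono x).monotone (Nat.zero_le p)

lemma pow_le_expansion {a : ℝ} (ha : 0 ≤ a) (h : ∀ e, a ≤ S.scale e) (p : ℕ) (x : C) :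
    a ^ p ≤ S.expansion p x := by
  induction p generalizing x with
  | zero => exact (pow_zero a).le
  | succ p ih =>
    rw [pow_succ', expansion_succ]
    exact mul_le_mul (h _) (ih _) (by positivity) (S.scale_pos _).le

lemma exists_scale_bounds : ∃ a b : ℝ, 1 < a ∧ ∀ e, a ≤ S.scale e ∧ S.scale e ≤ b := by
  obtain ⟨b, hb⟩ := (finite_range S.scale).bddAbove
  rcases isEmpty_or_nonempty (Fin S.m) with h | h
  -- There are no scale factors here, so any number above `1` serves.
  · exact ⟨2, b, by norm_num, fun e => isEmptyElim e⟩
  · obtain ⟨e₀, he₀⟩ := Finite.exists_min S.scale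
    exact ⟨S.scale e₀, b, S.one_lt_scale _, fun e => ⟨he₀ e, hb (mem_range_self e)⟩⟩

lemma exists_expansion_gt (T : ℝ) : ∃ p, ∀ x, T < S.expansion p x := by
  obtain ⟨a, b, ha, hab⟩ := S.exists_scale_bounds
  obtain ⟨p, hp⟩ := pow_unbounded_of_one_lt T ha
  exact ⟨p, fun x => hp.trans_le
    (S.pow_le_expansion (zero_le_one.trans ha.le) (fun e => (hab e).1) p x)⟩

lemma exists_expansion_lt_le {T : ℝ} (hT : 1 < T) (x : C) :
    ∃ p, S.expansion p x < T ∧ T ≤ S.expansion (p + 1) x := by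
  classical
  have hex : ∃ p, T ≤ S.expansion p x := (S.exists_expansion_gt T).imp fun p hp => (hp x).le
  have h0 : Nat.find hex ≠ 0 := by
    intro h
    have := Nat.find_spec hex
    rw [h] at this
    exact absurd this (not_le.2 hT)
  obtain ⟨p, hp⟩ := Nat.exists_eq_succ_of_ne_zero h0
  refine ⟨p, not_le.1 (Nat.find_min hex (by omega)), ?_⟩
  have := Nat.find_spec hex
  rwa [hp] at this

lemma dist_iterate {p : ℕ} {x y : C} (h : y ∈ S.cyl p x) :
    dist (S.τ^[p] x) (S.τ^[p] y) = S.expansion p x * dist x y := by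
  induction p generalizing x y with
  | zero => simp [expansion]
  | succ p ih =>
    rw [Function.iterate_succ_apply, Function.iterate_succ_apply, ih h.2,
      S.dist_τ_of_idx_eq h.1, expansion_succ]
    ring

lemma dist_iterate_of_mem {p : ℕ} {x y z : C} (hy : y ∈ S.cyl p x) (hz : z ∈ S.cyl p x) :
    dist (S.τ^[p] y) (S.τ^[p] z) = S.expansion p x * dist y z := by
  rw [S.dist_iterate (S.cyl_eq_of_mem hy ▸ hz), S.expansion_eq_of_mem hy]

lemma exists_mem_cyl_iterate_eq {p : ℕ} {x y : C}
    (h : S.modelIdx y = S.modelIdx (S.τ^[p] x)) : ∃ z ∈ S.cyl p x, S.τ^[p] z = y := by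
  induction p generalizing x y with
  | zero => exact ⟨y, h, rfl⟩
  | succ p ih =>
    obtain ⟨z, hz, rfl⟩ := ih (x := S.τ x) h
    have hz0 : S.modelIdx z = S.modelIdx (S.τ x) := S.cyl_antitone _ (Nat.zero_le p) hz
    rw [modelIdx_τ] at hz0
    obtain ⟨w, hw, rfl⟩ := S.exists_idx_eq_τ_eq hz0
    exact ⟨w, ⟨hw, hz⟩, rfl⟩

lemma image_iterate_cyl (p : ℕ) (x : C) :
    S.τ^[p] '' S.cyl p x = S.model (S.modelIdx (S.τ^[p] x)) := by
  ext y
  rw [mem_model_iff]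
  constructor
  · rintro ⟨z, hz, rfl⟩
    exact S.modelIdx_iterate_of_mem hz
  · exact fun h => S.exists_mem_cyl_iterate_eq h

lemma cyl_subset_of_inter_nonempty {p q : ℕ} (x y : C) (hpq : p ≤ q)
    (h : (S.cyl p x ∩ S.cyl q y).Nonempty) :
    S.cyl q y ⊆ S.cyl p x := by
  obtain ⟨z, hz, hz'⟩ := h
  rw [← S.cyl_eq_of_mem hz, ← S.cyl_eq_of_mem hz']
  exact S.cyl_antitone z hpq

lemma finite_range_cyl (p : ℕ) : (range (S.cyl p)).Finite := by
  induction p with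
  | zero =>
    refine (finite_range S.model).subset ?_
    rintro _ ⟨x, rfl⟩
    exact ⟨_, (S.cyl_zero x).symm⟩
  | succ p ih =>
    refine ((finite_univ (α := Fin S.m)).image2
      (fun e Z => {y | S.idx y = e ∧ S.τ y ∈ Z}) ih).subset ?_
    rintro _ ⟨x, rfl⟩
    exact ⟨S.idx x, mem_univ _, _, mem_range_self (S.τ x), rfl⟩

lemma finite_range_expansion (p : ℕ) : (range (S.expansion p)).Finite := by
  induction p with
  | zero => exact (finite_singleton (1 : ℝ)).subset (range_subset_iff.2 fun _ => rfl)
  | succ p ih =>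
    refine ((finite_range S.scale).image2 (fun a b => a * b) ih).subset ?_
    rintro _ ⟨x, rfl⟩
    exact ⟨_, mem_range_self (S.idx x), _, mem_range_self (S.τ x), rfl⟩

/-- Such a set is a union of cylinders of level `q`, of which there are finitely many. -/
lemma finite_saturated (q : ℕ) : {U : Set C | ∀ x ∈ U, S.cyl q x ⊆ U}.Finite := by
  refine ((S.finite_range_cyl q).finite_subsets.image sUnion).subset ?_
  intro U hU
  refine ⟨S.cyl q '' U, image_subset_range _ _, ?_⟩
  ext y
  simp only [sUnion_image, mem_iUnion]
  exact ⟨fun ⟨x, hx, hy⟩ => hU x hx hy, fun hy => ⟨y, hy, S.self_mem_cyl q y⟩⟩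

end Cylinders

/-! ### Size and separation of cylinders -/

section Metric

variable {C : Type*} [MetricSpace C] (S : CloneStructure C)

/-- Points of different level-1 clones have distance at least `ρ`. -/
def Separated (ρ : ℝ) : Prop := 0 < ρ ∧ ∀ x y, S.idx x ≠ S.idx y → ρ ≤ dist x y

lemma exists_separated [CompactSpace C] : ∃ ρ, S.Separated ρ := by
  obtain ⟨ρ, hρ, h⟩ := lebesgue_number_lemma_of_metric (isCompact_univ (X := C))
    (fun i => (S.isClopen_clone i).isOpen) S.iUnion_clone.ge
  refine ⟨ρ, hρ, fun x y hxy => ?_⟩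
  by_contra hlt
  obtain ⟨i, hi⟩ := h x (mem_univ x)
  have h1 := S.mem_clone_iff.1 (hi (Metric.mem_ball_self hρ))
  have h2 := S.mem_clone_iff.1 (hi (Metric.mem_ball'.2 (not_le.1 hlt)))
  exact hxy (h1.trans h2.symm)

variable {S} {ρ : ℝ}

/-- As long as the itineraries agree, `τ` scales the distance exactly; at the first disagreement it
is at least `ρ`, and the remaining factors are at least `1`. -/
lemma Separated.le_of_notMem (h : S.Separated ρ) {p : ℕ} {x y : C} (hy : y ∉ S.cyl p x) :
    ρ ≤ S.expansion p x * dist x y := by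
  induction p generalizing x y with
  | zero =>
    rw [expansion, one_mul]
    refine h.2 _ _ fun he => hy ?_
    rw [mem_cyl_zero, modelIdx, modelIdx, he]
  | succ p ih =>
    by_cases hxy : S.idx y = S.idx x
    · refine (ih fun h' => hy ⟨hxy, h'⟩).trans_eq ?_
      rw [S.dist_τ_of_idx_eq hxy, expansion_succ]
      ring
    · exact (h.2 _ _ (Ne.symm hxy)).trans
        (le_mul_of_one_le_left dist_nonneg (S.one_le_expansion _ _))

variable (S)

lemma isOpen_cyl [CompactSpace C] (p : ℕ) (x : C) : IsOpen (S.cyl p x) := by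
  obtain ⟨ρ, hρ⟩ := S.exists_separated
  rw [Metric.isOpen_iff]
  intro y hy
  refine ⟨ρ / S.expansion p y, div_pos hρ.1 (S.expansion_pos p y), fun z hz => ?_⟩
  rw [← S.cyl_eq_of_mem hy]
  by_contra hn
  have := hρ.le_of_notMem hn
  rw [Metric.mem_ball', lt_div_iff₀' (S.expansion_pos p y)] at hz
  exact absurd this (not_le.2 hz)

lemma isClopen_cyl [CompactSpace C] (p : ℕ) (x : C) : IsClopen (S.cyl p x) := by
  refine ⟨⟨?_⟩, S.isOpen_cyl p x⟩
  rw [show (S.cyl p x)ᶜ = ⋃ y ∈ (S.cyl p x)ᶜ, S.cyl p y from ?_]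
  · exact isOpen_biUnion fun y _ => S.isOpen_cyl p y
  · ext z
    simp only [mem_iUnion, exists_prop]
    refine ⟨fun hz => ⟨z, hz, S.self_mem_cyl p z⟩, fun ⟨y, hy, hz⟩ hzx => hy ?_⟩
    rw [← S.cyl_eq_of_mem hzx, S.cyl_eq_of_mem hz]
    exact S.self_mem_cyl p y

lemma exists_dist_le [CompactSpace C] : ∃ D : ℝ, 0 < D ∧ ∀ x y : C, dist x y ≤ D := by
  refine ⟨Metric.diam (univ : Set C) + 1, by positivity, fun x y => ?_⟩
  have := Metric.dist_le_diam_of_mem (isCompact_univ (X := C)).isBounded (mem_univ x) (mem_univ y)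
  linarith

lemma dist_le_of_mem_cyl {D : ℝ} (hD : ∀ x y : C, dist x y ≤ D) {p : ℕ} {x y : C}
    (hy : y ∈ S.cyl p x) : dist x y ≤ D / S.expansion p x := by
  rw [le_div_iff₀' (S.expansion_pos p x), ← S.dist_iterate hy]
  exact hD _ _

lemma exists_cyl_subset_ball [CompactSpace C] {ε : ℝ} (hε : 0 < ε) :
    ∃ p, ∀ x, S.cyl p x ⊆ Metric.ball x ε := by
  obtain ⟨D, hD, hdist⟩ := exists_dist_le (C := C)
  obtain ⟨p, hp⟩ := S.exists_expansion_gt (D / ε)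
  refine ⟨p, fun x y hy => Metric.mem_ball'.2 ?_⟩
  refine (S.dist_le_of_mem_cyl hdist hy).trans_lt ?_
  rw [div_lt_comm₀ (S.expansion_pos p x) hε]
  exact hp x

end Metric

end CloneStructure

/-! ### Perron–Frobenius: a parameter with a positive invariant vector -/

section PerronFrobenius

open Matrix Filter Topology

variable {ι : Type*} [Fintype ι]

lemma vecMul_pos_of_pos {A : Matrix ι ι ℝ} (hA : ∀ i j, 0 < A i j) {u : ι → ℝ} (hu : 0 ≤ u)
    (hu0 : u ≠ 0) (j : ι) : 0 < (u ᵥ* A) j := by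
  obtain ⟨i, hi⟩ := Function.ne_iff.1 hu0
  refine Finset.sum_pos' (fun i _ => mul_nonneg (hu i) (hA i j).le)
    ⟨i, Finset.mem_univ i, mul_pos (lt_of_le_of_ne (hu i) (Ne.symm hi)) (hA i j)⟩

variable [DecidableEq ι]

/-- A primitive matrix which has a nonnegative, nonzero subinvariant row vector `v ≤ v A` has a
positive row vector which is either invariant or strictly subinvariant. -/
lemma Matrix.IsPrimitive.exists_pos_invariant_or_lt {A : Matrix ι ι ℝ} (hA : A.IsPrimitive)
    {v : ι → ℝ} (hv : 0 ≤ v) (hv0 : v ≠ 0) (h : v ≤ v ᵥ* A) :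
    ∃ w : ι → ℝ, (∀ j, 0 < w j) ∧ (w ᵥ* A = w ∨ ∀ j, w j < (w ᵥ* A) j) := by
  obtain ⟨k, -, hk⟩ := hA.exists_pos_pow
  refine ⟨v ᵥ* A ^ k, vecMul_pos_of_pos hk hv hv0, ?_⟩
  have hcomm : (v ᵥ* A ^ k) ᵥ* A = (v ᵥ* A) ᵥ* A ^ k := by
    rw [vecMul_vecMul, vecMul_vecMul, ← pow_succ, ← pow_succ']
  rw [hcomm]
  by_cases he : v ᵥ* A = v
  · exact Or.inl (by rw [he])
  -- The defect `v A - v` is nonnegative and nonzero, so `A ^ k` makes it strictly positive.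
  · refine Or.inr fun j => ?_
    have := vecMul_pos_of_pos hk (sub_nonneg.2 h) (sub_ne_zero.2 he) j
    rw [sub_vecMul, Pi.sub_apply] at this
    exact sub_pos.1 this

/-- In a continuous family of primitive matrices for which subinvariant vectors exist for some
positive parameter but for no large one, some matrix has a positive invariant row vector. -/
lemma exists_pos_vecMul_eq {M : ℝ → Matrix ι ι ℝ} (hM : Continuous M)
    (hprim : ∀ d, 0 < d → (M d).IsPrimitive) {d₀ d₁ : ℝ} (hd₀ : 0 < d₀)
    (h₀ : ∃ v ∈ stdSimplex ℝ ι, v ≤ v ᵥ* M d₀)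
    (h₁ : ∀ d, d₁ ≤ d → ∀ v ∈ stdSimplex ℝ ι, ¬ v ≤ v ᵥ* M d) :
    ∃ δ : ℝ, 0 < δ ∧ ∃ v : ι → ℝ, (∀ j, 0 < v j) ∧ v ᵥ* M δ = v := by
  let P : Set (ℝ × (ι → ℝ)) := (Icc d₀ d₁ ×ˢ stdSimplex ℝ ι) ∩ {q | q.2 ≤ q.2 ᵥ* M q.1}
  have hP : IsCompact P :=
    (isCompact_Icc.prod (isCompact_stdSimplex ℝ ι)).inter_right
      (isClosed_le continuous_snd (continuous_snd.matrix_vecMul (hM.comp continuous_fst)))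
  have hmem : ∀ d, d₀ ≤ d → ∀ v ∈ stdSimplex ℝ ι, v ≤ v ᵥ* M d → (d, v) ∈ P :=
    fun d hd v hv hle => ⟨⟨⟨hd, (not_le.1 fun h => h₁ d h v hv hle).le⟩, hv⟩, hle⟩
  obtain ⟨v₀, hv₀, hle₀⟩ := h₀
  -- Take the largest parameter admitting a subinvariant vector; it exists by compactness of `P`.
  obtain ⟨⟨δ, v⟩, hδP, hmax⟩ := hP.exists_isMaxOn ⟨_, hmem d₀ le_rfl v₀ hv₀ hle₀⟩
    continuous_fst.continuousOn
  obtain ⟨⟨hδ, hv⟩, hle⟩ := hδP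
  have hδ0 : 0 < δ := hd₀.trans_le hδ.1
  have hv0 : v ≠ 0 := by
    rintro rfl
    simpa using hv.2
  refine ⟨δ, hδ0, ?_⟩
  obtain ⟨w, hw, h | h⟩ := (hprim δ hδ0).exists_pos_invariant_or_lt hv.1 hv0 hle
  · exact ⟨w, hw, h⟩
  exfalso
  -- Strict subinvariance is an open condition, so it survives at some `d > δ`; normalizing `w`
  -- contradicts maximality.
  have hev : ∀ᶠ d in 𝓝[>] δ, ∀ j, w j < (w ᵥ* M d) j := by
    refine (eventually_all.2 fun j => ?_).filter_mono nhdsWithin_le_nhds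
    exact continuousAt_const.eventually_lt
      ((continuous_apply j).comp (continuous_const.matrix_vecMul hM)).continuousAt (h j)
  obtain ⟨d, hd, hdδ⟩ := (hev.and self_mem_nhdsWithin).exists
  have hne : Nonempty ι := not_isEmpty_iff.1 fun _ => hv0 (Subsingleton.elim _ _)
  have hsum : 0 < ∑ j, w j := Finset.sum_pos (fun j _ => hw j) Finset.univ_nonempty
  refine absurd (hmax (hmem d (hδ.1.trans (le_of_lt hdδ)) ((∑ j, w j)⁻¹ • w) ⟨fun j => ?_, ?_⟩ ?_))
    (not_le.2 hdδ)
  · exact mul_nonneg (inv_nonneg.2 hsum.le) (hw j).le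
  · simp only [Pi.smul_apply, smul_eq_mul, ← Finset.mul_sum]
    exact inv_mul_cancel₀ hsum.ne'
  · rw [smul_vecMul]
    exact fun j => mul_le_mul_of_nonneg_left (hd j).le (inv_nonneg.2 hsum.le)

end PerronFrobenius

/-! ### Existence of a conformal vector -/

namespace CloneStructure

variable {C : Type*} [MetricSpace C] (S : CloneStructure C)

open Matrix in
lemma vecMul_matrix_apply (d : ℝ) (v : Fin S.n → ℝ) (j : Fin S.n) :
    (v ᵥ* S.matrix d) j =
      ∑ e with S.loc e = j, ((S.scale e)⁻¹) ^ d * v (S.type e) := by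
  simp only [vecMul, dotProduct, matrix, of_apply, Finset.mul_sum]
  rw [← Finset.sum_fiberwise (Finset.univ.filter fun e => S.loc e = j) S.type]
  refine Finset.sum_congr rfl fun i _ => ?_
  rw [Finset.filter_filter]
  refine Finset.sum_congr ?_ fun e he => ?_
  · ext e
    simp [and_comm]
  · rw [← (Finset.mem_filter.1 he).2.2, mul_comm]

lemma continuous_matrix : Continuous S.matrix := by
  refine _root_.continuous_matrix fun i j => ?_
  simp only [matrix, Matrix.of_apply]
  exact continuous_finsetSum _ fun e _ =>
    Real.continuous_const_rpow (inv_pos.2 (S.scale_pos e)).ne'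

/-- A positive vector `v` is conformal of dimension `δ` if it is the vector of the values on
models of a finitely additive measure which `τ` scales as a `δ`-dimensional measure. -/
structure IsConformal (δ : ℝ) (v : Fin S.n → ℝ) : Prop where
  dim_pos : 0 < δ
  pos : ∀ j, 0 < v j
  sum_eq : ∀ j, ∑ e with S.loc e = j, ((S.scale e)⁻¹) ^ δ * v (S.type e) = v j

variable {S}

/-- At `d = log 2 / log b` every `k_e ^ (-d)` is at least `1/2` and each model has two clones, so
the uniform vector is subinvariant. For `d` at least `(log m + 1) / log a` every `k_e ^ (-d)` is
below `1/m`, so the total mass strictly drops and no subinvariant probability vector exists. -/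
lemma IsIrreducible.exists_isConformal [Nonempty C] (hS : S.IsIrreducible) :
    ∃ δ v, S.IsConformal δ v := by
  obtain ⟨a, b, ha, hab⟩ := S.exists_scale_bounds
  obtain ⟨x⟩ := ‹Nonempty C›
  have hb : 1 < b := ha.trans_le ((hab (S.idx x)).1.trans (hab (S.idx x)).2)
  have : Nonempty (Fin S.n) := ⟨S.modelIdx x⟩
  have hn : (0 : ℝ) < S.n := by exact_mod_cast (Fin.pos (S.modelIdx x))
  have hm : (0 : ℝ) < S.m := by exact_mod_cast (Fin.pos (S.idx x))
  have hlogb : 0 < Real.log b := Real.log_pos hb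
  have hd₀ : 0 < Real.log 2 / Real.log b := div_pos (Real.log_pos one_lt_two) hlogb
  have hloga : 0 < Real.log a := Real.log_pos ha
  suffices h : _ ∧ _ by
    obtain ⟨δ, hδ, v, hv, hfix⟩ := exists_pos_vecMul_eq (d₁ := (Real.log S.m + 1) / Real.log a)
      S.continuous_matrix hS hd₀ h.1 h.2
    exact ⟨δ, v, hδ, hv, fun j => by rw [← vecMul_matrix_apply, hfix]⟩
  constructor
  · refine ⟨fun _ => (S.n : ℝ)⁻¹, ⟨fun _ => (inv_pos.2 hn).le, by simp [hn.ne']⟩, fun j => ?_⟩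
    rw [vecMul_matrix_apply, ← Finset.sum_mul]
    refine le_mul_of_one_le_left (inv_pos.2 hn).le ?_
    have key : ∀ e, (2 : ℝ)⁻¹ ≤ ((S.scale e)⁻¹) ^ (Real.log 2 / Real.log b) := by
      intro e
      have h2 : (b⁻¹) ^ (Real.log 2 / Real.log b) = (2 : ℝ)⁻¹ := by
        rw [Real.inv_rpow (by positivity), Real.rpow_def_of_pos (by positivity),
          mul_div_cancel₀ _ hlogb.ne', Real.exp_log two_pos]
      rw [← h2]
      exact Real.rpow_le_rpow (by positivity)
        (inv_anti₀ (S.scale_pos e) (hab e).2) hd₀.le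
    calc (1 : ℝ) = 2 * 2⁻¹ := by norm_num
      _ ≤ (Finset.univ.filter fun e => S.loc e = j).card * (2 : ℝ)⁻¹ := by
        have : (2 : ℝ) ≤ (Finset.univ.filter fun e => S.loc e = j).card := by
          exact_mod_cast S.two_le_card j
        gcongr
      _ ≤ _ := by
        rw [← nsmul_eq_mul]
        exact Finset.card_nsmul_le_sum _ _ _ fun e _ => key e
  · intro d hd v hv hle
    have hd0 : Real.log S.m + 1 ≤ d * Real.log a := (div_le_iff₀ hloga).1 hd
    have hdpos : 0 ≤ d := by
      have : 0 ≤ Real.log S.m := Real.log_natCast_nonneg _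
      by_contra hneg
      nlinarith [mul_neg_of_neg_of_pos (not_le.1 hneg) hloga]
    have key : ∀ e, ((S.scale e)⁻¹) ^ d < (S.m : ℝ)⁻¹ := by
      intro e
      calc ((S.scale e)⁻¹) ^ d ≤ (a⁻¹) ^ d :=
            Real.rpow_le_rpow (inv_pos.2 (S.scale_pos e)).le
              (inv_anti₀ (by positivity) (hab e).1) hdpos
        _ = (Real.exp (d * Real.log a))⁻¹ := by
            rw [Real.inv_rpow (by positivity), Real.rpow_def_of_pos (by positivity), mul_comm]
        _ < (S.m : ℝ)⁻¹ := by
            refine inv_strictAnti₀ hm ?_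
            rw [← Real.log_lt_iff_lt_exp hm]
            linarith
    have hsum : ∑ j, v j ≤ ∑ e, ((S.scale e)⁻¹) ^ d * v (S.type e) := by
      rw [← Finset.sum_fiberwise Finset.univ S.loc]
      refine Finset.sum_le_sum fun j _ => ?_
      rw [← vecMul_matrix_apply]
      exact hle j
    have hlt : ∑ e, ((S.scale e)⁻¹) ^ d * v (S.type e) < ∑ e : Fin S.m, (S.m : ℝ)⁻¹ := by
      refine Finset.sum_lt_sum_of_nonempty ⟨S.idx x, Finset.mem_univ _⟩ fun e _ => ?_
      refine (mul_le_of_le_one_right ?_ ?_).trans_lt (key e)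
      · exact Real.rpow_nonneg (inv_pos.2 (S.scale_pos e)).le _
      · rw [← hv.2]
        exact Finset.single_le_sum (fun j _ => hv.1 j) (Finset.mem_univ _)
    rw [hv.2] at hsum
    simp only [Finset.sum_const, Finset.card_univ, Fintype.card_fin, nsmul_eq_mul,
      mul_inv_cancel₀ hm.ne'] at hlt
    exact absurd hsum (not_le.2 hlt)

end CloneStructure

namespace CloneStructure

variable {C : Type*} [MetricSpace C] {S : CloneStructure C} {δ : ℝ} {v : Fin S.n → ℝ}

/-! ### Finiteness of the Hausdorff measure -/

section UpperBound

lemma ediam_clone_inter_preimage_le (e : Fin S.m) (t : Set C) :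
    Metric.ediam (S.clone e ∩ S.τ ⁻¹' t) ≤
      ENNReal.ofReal (S.scale e)⁻¹ * Metric.ediam t := by
  refine Metric.ediam_le fun x hx y hy => ?_
  have h := S.dist_τ e x hx.1 y hy.1
  rw [edist_dist, show dist x y = (S.scale e)⁻¹ * dist (S.τ x) (S.τ y) by
      rw [h, inv_mul_cancel_left₀ (S.scale_pos e).ne'],
    ENNReal.ofReal_mul (inv_nonneg.2 (S.scale_pos e).le), ← edist_dist]
  gcongr
  exact Metric.edist_le_ediam_of_mem hx.2 hy.2

/-- Pull covers of the models back through the clone maps: the mesh shrinks by `a⁻¹` at each level,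
while `sum_eq` keeps the bound on the `δ`-sum unchanged. The constant `c` absorbs level `0`. -/
lemma IsConformal.exists_cover (hv : S.IsConformal δ v) {a D c : ℝ} (ha : 1 < a)
    (hscale : ∀ e, a ≤ S.scale e) (hD : 0 < D) (hdist : ∀ x y : C, dist x y ≤ D)
    (hc : ∀ j, D ^ δ ≤ c * v j) (p : ℕ) (j : Fin S.n) :
    ∃ (ι : Type) (_ : Fintype ι) (t : ι → Set C),
      (∀ i, Metric.ediam (t i) ≤ ENNReal.ofReal (D * (a⁻¹) ^ p)) ∧ S.model j ⊆ ⋃ i, t i ∧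
        ∑ i, Metric.ediam (t i) ^ δ ≤ ENNReal.ofReal (c * v j) := by
  have ha0 : 0 < a := zero_lt_one.trans ha
  have hcv : ∀ j, 0 ≤ c * v j := fun j => (Real.rpow_nonneg hD.le δ).trans (hc j)
  induction p generalizing j with
  | zero =>
    have hle : Metric.ediam (S.model j) ≤ ENNReal.ofReal D := by
      refine Metric.ediam_le fun x _ y _ => ?_
      rw [edist_dist]
      exact ENNReal.ofReal_le_ofReal (hdist x y)
    refine ⟨Unit, inferInstance, fun _ => S.model j, fun _ => by simpa using hle,
      subset_iUnion_of_subset () Subset.rfl, ?_⟩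
    rw [Fintype.sum_unique]
    calc Metric.ediam (S.model j) ^ δ ≤ ENNReal.ofReal D ^ δ :=
          ENNReal.rpow_le_rpow hle hv.dim_pos.le
      _ = ENNReal.ofReal (D ^ δ) := ENNReal.ofReal_rpow_of_pos hD
      _ ≤ _ := ENNReal.ofReal_le_ofReal (hc j)
  | succ p ih =>
    choose ι hι t hdiam hcov hsum using ih
    refine ⟨Σ e : {e // S.loc e = j}, ι (S.type e), inferInstance,
      fun i => S.clone i.1 ∩ S.τ ⁻¹' t _ i.2, ?_, ?_, ?_⟩
    · rintro ⟨e, i⟩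
      refine (ediam_clone_inter_preimage_le _ _).trans ?_
      rw [pow_succ', mul_left_comm, ENNReal.ofReal_mul (inv_nonneg.2 ha0.le)]
      exact mul_le_mul' (ENNReal.ofReal_le_ofReal (inv_anti₀ ha0 (hscale _))) (hdiam _ i)
    · intro x hx
      rw [mem_model_iff] at hx
      have hτ := hcov _ (S.mem_model_iff.2 (S.modelIdx_τ x))
      obtain ⟨i, hi⟩ := mem_iUnion.1 hτ
      exact mem_iUnion.2 ⟨⟨⟨S.idx x, hx⟩, i⟩, S.mem_clone_idx x, hi⟩
    · rw [Fintype.sum_sigma]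
      calc _ ≤ ∑ e : {e // S.loc e = j},
            ENNReal.ofReal (((S.scale e)⁻¹) ^ δ * (c * v (S.type e))) := by
            refine Finset.sum_le_sum fun e _ => ?_
            have hk : 0 < (S.scale e)⁻¹ := inv_pos.2 (S.scale_pos _)
            calc _ ≤ ∑ i, ENNReal.ofReal (((S.scale e)⁻¹) ^ δ) *
                    Metric.ediam (t (S.type e) i) ^ δ := by
                  refine Finset.sum_le_sum fun i _ => ?_
                  refine (ENNReal.rpow_le_rpow (ediam_clone_inter_preimage_le _ _)
                    hv.dim_pos.le).trans_eq ?_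
                  rw [ENNReal.mul_rpow_of_nonneg _ _ hv.dim_pos.le,
                    ENNReal.ofReal_rpow_of_pos hk]
              _ ≤ _ := by
                  rw [← Finset.mul_sum, ENNReal.ofReal_mul (Real.rpow_nonneg hk.le _)]
                  gcongr
                  exact hsum _
        _ = ENNReal.ofReal (c * v j) := by
            rw [← ENNReal.ofReal_sum_of_nonneg fun e _ => mul_nonneg
              (Real.rpow_nonneg (inv_nonneg.2 (S.scale_pos _).le) _) (hcv _)]
            congr 1
            rw [← hv.sum_eq j, Finset.mul_sum,
              ← Finset.sum_subtype (Finset.univ.filter fun e => S.loc e = j) (by simp)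
                (fun e => ((S.scale e)⁻¹) ^ δ * (c * v (S.type e)))]
            exact Finset.sum_congr rfl fun e _ => by ring

lemma IsConformal.hausdorffMeasure_model_ne_top [CompactSpace C] [MeasurableSpace C]
    [BorelSpace C] (hv : S.IsConformal δ v) (j : Fin S.n) :
    Measure.hausdorffMeasure δ (S.model j) ≠ ∞ := by
  obtain ⟨a, b, ha, hab⟩ := S.exists_scale_bounds
  obtain ⟨D, hD, hdist⟩ := exists_dist_le (C := C)
  obtain ⟨c, hc⟩ := (finite_range fun j => D ^ δ / v j).bddAbove
  have hc' : ∀ j, D ^ δ ≤ c * v j := fun j => (div_le_iff₀ (hv.pos j)).1 (hc (mem_range_self j))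
  choose ι hι t hdiam hcov hsum using
    fun p => hv.exists_cover ha (fun e => (hab e).1) hD hdist hc' p j
  have ha0 : 0 ≤ a⁻¹ := inv_nonneg.2 (zero_le_one.trans ha.le)
  have hlim : Filter.Tendsto (fun p => ENNReal.ofReal (D * (a⁻¹) ^ p)) Filter.atTop (nhds 0) := by
    have := ((tendsto_pow_atTop_nhds_zero_of_lt_one ha0 (inv_lt_one_of_one_lt₀ ha)).const_mul D)
    rw [mul_zero] at this
    rw [← ENNReal.ofReal_zero]
    exact (ENNReal.continuous_ofReal.tendsto 0).comp this
  have hle := Measure.hausdorffMeasure_le_liminf_sum δ (S.model j) _ hlim t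
    (Filter.Eventually.of_forall hdiam) (Filter.Eventually.of_forall hcov)
  refine ne_top_of_le_ne_top (ENNReal.ofReal_ne_top (r := c * v j)) (hle.trans ?_)
  exact (Filter.liminf_le_liminf (Filter.Eventually.of_forall hsum)).trans_eq (Filter.liminf_const _)

end UpperBound

/-! ### Positivity of the Hausdorff measure by mass distribution -/

section LowerBound

open Classical in
/-- The total conformal weight of the cylinders of level `N` in the model `j` which meet `B`. -/
noncomputable def weight (S : CloneStructure C) (δ : ℝ) (v : Fin S.n → ℝ) :
    ℕ → Set C → Fin S.n → ℝ
  | 0, B, j => if (B ∩ S.model j).Nonempty then v j else 0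
  | N + 1, B, j => ∑ e with S.loc e = j,
      ((S.scale e)⁻¹) ^ δ * weight S δ v N (S.τ '' (B ∩ S.clone e)) (S.type e)

lemma weight_succ (N : ℕ) (B : Set C) (j : Fin S.n) :
    S.weight δ v (N + 1) B j = ∑ e with S.loc e = j,
      ((S.scale e)⁻¹) ^ δ * S.weight δ v N (S.τ '' (B ∩ S.clone e)) (S.type e) := rfl

lemma inv_scale_rpow_nonneg (e : Fin S.m) : 0 ≤ ((S.scale e)⁻¹) ^ δ :=
  Real.rpow_nonneg (inv_nonneg.2 (S.scale_pos e).le) δ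

lemma weight_empty (N : ℕ) (j : Fin S.n) : S.weight δ v N ∅ j = 0 := by
  induction N generalizing j with
  | zero => simp [weight]
  | succ N ih => simp [weight_succ, ih]

namespace IsConformal

variable (hv : S.IsConformal δ v)
include hv

lemma weight_mono (N : ℕ) {B B' : Set C} (h : B ⊆ B') (j : Fin S.n) :
    S.weight δ v N B j ≤ S.weight δ v N B' j := by
  induction N generalizing B B' j with
  | zero =>
    simp only [weight]
    split_ifs with h1 h2
    · exact le_rfl
    · exact absurd (h1.mono (inter_subset_inter_left _ h)) h2
    · exact (hv.pos j).le
    · exact le_rfl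
  | succ N ih =>
    rw [weight_succ, weight_succ]
    exact Finset.sum_le_sum fun e _ => mul_le_mul_of_nonneg_left
      (ih (image_mono (inter_subset_inter_left _ h)) _) (inv_scale_rpow_nonneg e)

lemma weight_nonneg (N : ℕ) (B : Set C) (j : Fin S.n) : 0 ≤ S.weight δ v N B j :=
  (weight_empty N j).symm.trans_le (hv.weight_mono N (empty_subset B) j)

lemma weight_union_le (N : ℕ) (B B' : Set C) (j : Fin S.n) :
    S.weight δ v N (B ∪ B') j ≤ S.weight δ v N B j + S.weight δ v N B' j := by
  induction N generalizing B B' j with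
  | zero =>
    have := hv.pos j
    have hu : ((B ∪ B') ∩ S.model j).Nonempty ↔
        (B ∩ S.model j).Nonempty ∨ (B' ∩ S.model j).Nonempty := by
      rw [union_inter_distrib_right, union_nonempty]
    simp only [weight]
    split_ifs <;> first | linarith | tauto
  | succ N ih =>
    rw [weight_succ, weight_succ, weight_succ, ← Finset.sum_add_distrib]
    refine Finset.sum_le_sum fun e _ => ?_
    rw [← mul_add, union_inter_distrib_right, image_union]
    exact mul_le_mul_of_nonneg_left (ih _ _ _) (inv_scale_rpow_nonneg e)

lemma weight_biUnion_le {ι : Type*} (N : ℕ) (s : Finset ι) (B : ι → Set C) (j : Fin S.n) :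
    S.weight δ v N (⋃ i ∈ s, B i) j ≤ ∑ i ∈ s, S.weight δ v N (B i) j := by
  classical
  induction s using Finset.induction_on with
  | empty => simp [weight_empty]
  | insert i s hi ih =>
    rw [Finset.set_biUnion_insert, Finset.sum_insert hi]
    exact (hv.weight_union_le N _ _ j).trans (by gcongr)

lemma weight_model (N : ℕ) (j : Fin S.n) : S.weight δ v N (S.model j) j = v j := by
  induction N generalizing j with
  | zero => simp [weight, S.nonempty_model j]
  | succ N ih =>
    rw [weight_succ, ← hv.sum_eq j]
    refine Finset.sum_congr rfl fun e he => ?_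
    have hsub := S.clone_subset e
    rw [(Finset.mem_filter.1 he).2] at hsub
    rw [inter_eq_self_of_subset_right hsub, S.image_clone, ih]

/-- Subdividing a cylinder preserves its weight, so the bound does not depend on `N`. At a level `N
< p` the weight would count larger cylinders that merely meet `B`. -/
lemma weight_cyl_le {p N : ℕ} (hpN : p ≤ N) (x : C) {B : Set C} (hB : B ⊆ S.cyl p x)
    (j : Fin S.n) :
    S.weight δ v N B j ≤ ((S.expansion p x)⁻¹) ^ δ * v (S.modelIdx (S.τ^[p] x)) := by
  induction p generalizing N x B j with
  | zero =>
    rw [cyl_zero] at hB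
    simp only [expansion, inv_one, Real.one_rpow, one_mul, Function.iterate_zero, id]
    by_cases hj : S.modelIdx x = j
    · subst hj
      exact (hv.weight_mono N hB _).trans_eq (hv.weight_model N _)
    · refine le_of_eq_of_le ?_ (hv.pos _).le
      have hdisj : B ∩ S.model j = ∅ :=
        disjoint_iff_inter_eq_empty.1 ((S.disjoint_model hj).mono_left hB)
      cases N with
      | zero => simp [weight, hdisj]
      | succ N =>
        rw [weight_succ]
        refine Finset.sum_eq_zero fun e he => ?_
        have hsub := S.clone_subset e
        rw [(Finset.mem_filter.1 he).2] at hsub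
        rw [subset_empty_iff.1 ((inter_subset_inter_right B hsub).trans hdisj.subset),
          image_empty, weight_empty, mul_zero]
  | succ p ih =>
    obtain ⟨N, rfl⟩ := Nat.exists_eq_succ_of_ne_zero (show N ≠ 0 by omega)
    set R := ((S.expansion (p + 1) x)⁻¹) ^ δ * v (S.modelIdx (S.τ^[p + 1] x)) with hR
    have hR0 : 0 ≤ R :=
      mul_nonneg (Real.rpow_nonneg (inv_nonneg.2 (S.expansion_pos _ _).le) _) (hv.pos _).le
    rw [weight_succ]
    calc _ ≤ ∑ e with S.loc e = j, if e = S.idx x then R else 0 := by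
          refine Finset.sum_le_sum fun e _ => ?_
          split_ifs with he
          · subst he
            have := ih (N := N) (by omega) (S.τ x) (B := S.τ '' (B ∩ S.clone (S.idx x)))
              (by rintro _ ⟨y, hy, rfl⟩; exact (hB hy.1).2) (S.type (S.idx x))
            refine (mul_le_mul_of_nonneg_left this (inv_scale_rpow_nonneg _)).trans_eq ?_
            rw [hR, expansion_succ, mul_inv, Real.mul_rpow (inv_nonneg.2 (S.scale_pos _).le)
              (inv_nonneg.2 (S.expansion_pos _ _).le), mul_assoc]
            rfl
          · have : B ∩ S.clone e = ∅ := by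
              refine subset_empty_iff.1 fun y hy => he ?_
              rw [← S.mem_clone_iff.1 hy.2, (hB hy.1).1]
            rw [this, image_empty, weight_empty, mul_zero]
      _ ≤ R := by
          rw [Finset.sum_ite_eq']
          split_ifs
          · exact le_rfl
          · exact hR0

/-- A nonempty set of small diameter lies in a cylinder whose conformal weight is controlled by
the diameter of the set. -/
lemma exists_subset_cyl {ρ b w ε : ℝ} (hρ : S.Separated ρ) (hb : ∀ e, S.scale e ≤ b)
    (hw : ∀ j, v j ≤ w) (hε : 0 < ε) {t : Set C} {x : C} (hx : x ∈ t) {d : ℝ}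
    (ht : ∀ y ∈ t, dist x y ≤ d) (hd : d < ρ) :
    ∃ p, t ⊆ S.cyl p x ∧ ((S.expansion p x)⁻¹) ^ δ * v (S.modelIdx (S.τ^[p] x)) ≤
      (b / ρ) ^ δ * w * d ^ δ + ε := by
  classical
  have hd0 : 0 ≤ d := dist_nonneg.trans (ht x hx)
  have hb0 : 0 < b := (S.scale_pos (S.idx x)).trans_le (hb _)
  have hw0 : 0 < w := (hv.pos (S.modelIdx x)).trans_le (hw _)
  have hρ0 := hρ.1
  -- If `t` lies in arbitrarily deep cylinders, as a singleton does, the diameter term may vanish; a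
  -- deep enough cylinder has weight at most `ε`.
  by_cases hall : ∀ p, t ⊆ S.cyl p x
  · obtain ⟨p, hp⟩ := S.exists_expansion_gt ((w / ε) ^ δ⁻¹)
    refine ⟨p, hall p, le_add_of_nonneg_of_le (by positivity) ?_⟩
    have h1 : w / ε ≤ S.expansion p x ^ δ := by
      calc w / ε = ((w / ε) ^ δ⁻¹) ^ δ := by
            rw [← Real.rpow_mul (by positivity), inv_mul_cancel₀ hv.dim_pos.ne', Real.rpow_one]
        _ ≤ _ := Real.rpow_le_rpow (by positivity) (hp x).le hv.dim_pos.le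
    have hE := S.expansion_pos p x
    rw [Real.inv_rpow hE.le, inv_mul_le_iff₀ (Real.rpow_pos_of_pos hE _)]
    rw [div_le_iff₀ hε] at h1
    exact (hw _).trans h1
  · push Not at hall
    have h0 : Nat.find hall ≠ 0 := by
      intro h
      refine Nat.find_spec hall ?_
      rw [h]
      intro y hy
      by_contra hn
      have := hρ.le_of_notMem hn
      rw [expansion, one_mul] at this
      linarith [ht y hy]
    obtain ⟨p, hp⟩ := Nat.exists_eq_succ_of_ne_zero h0
    have hsub : t ⊆ S.cyl p x := not_not.1 (Nat.find_min hall (by omega))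
    have hnot := Nat.find_spec hall
    rw [hp] at hnot
    obtain ⟨y, hy, hyn⟩ := not_subset.1 hnot
    refine ⟨p, hsub, le_add_of_le_of_nonneg ?_ hε.le⟩
    have hE := S.expansion_pos p x
    -- Some `y ∈ t` leaves the cylinder at level `p + 1`, so `d` is at least `ρ / expansion (p + 1)
    -- x`.
    have h1 : ρ ≤ S.expansion p x * b * d := by
      refine (hρ.le_of_notMem hyn).trans ?_
      rw [expansion_succ']
      have := ht y hy
      have := hb (S.idx (S.τ^[p] x))
      gcongr
    have h2 : (S.expansion p x)⁻¹ ≤ b / ρ * d := by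
      rw [inv_le_iff_one_le_mul₀ hE, div_mul_eq_mul_div, div_mul_eq_mul_div, one_le_div hρ0]
      linarith
    calc _ ≤ (b / ρ * d) ^ δ * w := by
          have := hv.dim_pos.le
          have := (hv.pos (S.modelIdx (S.τ^[p] x))).le
          have := hw (S.modelIdx (S.τ^[p] x))
          gcongr
      _ = _ := by
          rw [Real.mul_rpow (by positivity) hd0]
          ring

lemma hausdorffMeasure_model_ne_zero [CompactSpace C] [MeasurableSpace C] [BorelSpace C]
    (j : Fin S.n) : Measure.hausdorffMeasure δ (S.model j) ≠ 0 := by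
  obtain ⟨a, b, ha, hab⟩ := S.exists_scale_bounds
  obtain ⟨ρ, hρ⟩ := S.exists_separated
  obtain ⟨w, hw⟩ := (finite_range v).bddAbove
  have hw' : ∀ j, v j ≤ w := fun j => hw (mem_range_self j)
  have hw0 : 0 < w := (hv.pos j).trans_le (hw' j)
  obtain ⟨x₀, -⟩ := S.nonempty_model j
  have hb0 : 0 < b := (S.scale_pos (S.idx x₀)).trans_le (hab _).2
  have hρ0 := hρ.1
  set c := (b / ρ) ^ δ * w with hc
  have hc0 : 0 < c := by positivity
  have hr : (0 : ℝ≥0∞) < ENNReal.ofReal (ρ / 2) := by simpa using hρ0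
  suffices h : ENNReal.ofReal (v j) ≤
      ENNReal.ofReal c * Measure.hausdorffMeasure δ (S.model j) by
    intro h0
    rw [h0, mul_zero, nonpos_iff_eq_zero, ENNReal.ofReal_eq_zero] at h
    exact absurd (hv.pos j) (not_lt.2 h)
  rw [← ENNReal.div_le_iff' (by simpa using hc0) ENNReal.ofReal_ne_top,
    Measure.hausdorffMeasure_apply]
  refine le_iSup₂_of_le _ hr (le_iInf fun t => le_iInf₂ fun hcov hdiam => ?_)
  rw [ENNReal.div_le_iff' (by simpa using hc0) ENNReal.ofReal_ne_top,
    ← ENNReal.tsum_mul_left]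
  refine ENNReal.le_of_forall_pos_le_add fun ε hε _ => ?_
  obtain ⟨ε', hε', hεsum⟩ := ENNReal.exists_pos_sum_of_countable
    (ENNReal.coe_ne_zero.2 hε.ne') ℕ
  -- Replace each covering set by an open cylinder of comparable weight. Compactness then leaves
  -- finitely many, whose weights can be compared at one common level `N`.
  have hZ : ∀ i, ∃ Z : Set C, IsOpen Z ∧ t i ⊆ Z ∧ ∃ p, ∀ N, p ≤ N →
      ENNReal.ofReal (S.weight δ v N Z j) ≤
        ENNReal.ofReal c * (⨆ _ : (t i).Nonempty, Metric.ediam (t i) ^ δ) + ε' i := by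
    intro i
    rcases (t i).eq_empty_or_nonempty with hi | hi
    · exact ⟨∅, isOpen_empty, hi.subset, 0, fun N _ => by simp [weight_empty]⟩
    · obtain ⟨x, hx⟩ := hi
      have hfin : Metric.ediam (t i) ≠ ∞ := ne_top_of_le_ne_top ENNReal.ofReal_ne_top (hdiam i)
      have hd : Metric.diam (t i) < ρ :=
        (ENNReal.toReal_le_of_le_ofReal (by positivity) (hdiam i)).trans_lt (half_lt_self hρ0)
      obtain ⟨p, hp, hle⟩ := hv.exists_subset_cyl hρ (fun e => (hab e).2) hw'
        (NNReal.coe_pos.2 (hε' i)) hx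
        (fun y hy => Metric.dist_le_diam_of_mem (Metric.isBounded_iff_ediam_ne_top.2 hfin) hx hy) hd
      refine ⟨_, S.isOpen_cyl p x, hp, p, fun N hN => ?_⟩
      refine (ENNReal.ofReal_le_ofReal
        ((hv.weight_cyl_le hN x Subset.rfl j).trans hle)).trans_eq ?_
      rw [ENNReal.ofReal_add (by positivity) (by positivity), ENNReal.ofReal_mul hc0.le,
        ENNReal.ofReal_coe_nnreal, iSup_pos ⟨x, hx⟩, Metric.diam,
        ← ENNReal.ofReal_rpow_of_nonneg ENNReal.toReal_nonneg hv.dim_pos.le,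
        ENNReal.ofReal_toReal hfin]
  choose Z hZo htZ p hp using hZ
  obtain ⟨s, hs⟩ := (S.isClopen_model j).isClosed.isCompact.elim_finite_subcover Z hZo
    (hcov.trans (iUnion_mono htZ))
  set N := s.sup p
  calc ENNReal.ofReal (v j) = ENNReal.ofReal (S.weight δ v N (S.model j) j) := by
        rw [hv.weight_model]
    _ ≤ ENNReal.ofReal (∑ i ∈ s, S.weight δ v N (Z i) j) :=
        ENNReal.ofReal_le_ofReal ((hv.weight_mono N hs j).trans (hv.weight_biUnion_le N s Z j))
    _ ≤ ∑ i ∈ s, ENNReal.ofReal (S.weight δ v N (Z i) j) := 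
        (ENNReal.ofReal_sum_of_nonneg fun i _ => hv.weight_nonneg N (Z i) j).le
    _ ≤ ∑ i ∈ s, (ENNReal.ofReal c * (⨆ _ : (t i).Nonempty, Metric.ediam (t i) ^ δ) + ε' i) :=
        Finset.sum_le_sum fun i hi => hp i N (Finset.le_sup hi)
    _ ≤ ∑' i, (ENNReal.ofReal c * (⨆ _ : (t i).Nonempty, Metric.ediam (t i) ^ δ) + ε' i) :=
        ENNReal.sum_le_tsum s
    _ ≤ _ := by
        rw [ENNReal.tsum_add]
        gcongr

end IsConformal

end LowerBound

end CloneStructure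

/-! ### Scaling of Hausdorff measure under similarities -/

section Similarity

variable {X Y : Type*} [MetricSpace X] [MeasurableSpace X] [BorelSpace X]
  [MetricSpace Y] [MeasurableSpace Y] [BorelSpace Y]

lemma hausdorffMeasure_image_of_dist_eq {g : X → Y} {s : Set X} {L d : ℝ} (hL : 0 < L)
    (hd : 0 ≤ d) (h : ∀ x ∈ s, ∀ y ∈ s, dist (g x) (g y) = L * dist x y) :
    Measure.hausdorffMeasure d (g '' s) = ENNReal.ofReal (L ^ d) * Measure.hausdorffMeasure d s := by
  rcases s.eq_empty_or_nonempty with rfl | ⟨x₀, hx₀⟩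
  · simp
  have : Nonempty X := ⟨x₀⟩
  have hinj : InjOn g s := fun x hx y hy hxy => by
    have := h x hx y hy
    rw [hxy, dist_self] at this
    exact dist_eq_zero.1 ((mul_eq_zero.1 this.symm).resolve_left hL.ne')
  have hlip : LipschitzOnWith L.toNNReal g s := LipschitzOnWith.of_dist_le_mul fun x hx y hy => by
    rw [h x hx y hy, Real.coe_toNNReal _ hL.le]
  have hlip' : LipschitzOnWith L⁻¹.toNNReal (Function.invFunOn g s) (g '' s) := by
    refine LipschitzOnWith.of_dist_le_mul ?_
    rintro _ ⟨x, hx, rfl⟩ _ ⟨y, hy, rfl⟩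
    rw [hinj.leftInvOn_invFunOn hx, hinj.leftInvOn_invFunOn hy, h x hx y hy,
      Real.coe_toNNReal _ (inv_nonneg.2 hL.le), inv_mul_cancel_left₀ hL.ne']
  have h1 := hlip.hausdorffMeasure_image_le hd
  have h2 := hlip'.hausdorffMeasure_image_le hd
  rw [image_image, image_congr hinj.leftInvOn_invFunOn, image_id'] at h2
  change _ ≤ ENNReal.ofReal L⁻¹ ^ d * _ at h2
  change _ ≤ ENNReal.ofReal L ^ d * _ at h1
  rw [ENNReal.ofReal_rpow_of_pos (inv_pos.2 hL)] at h2
  rw [ENNReal.ofReal_rpow_of_pos hL] at h1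
  refine le_antisymm h1 ?_
  calc _ ≤ ENNReal.ofReal (L ^ d) * (ENNReal.ofReal (L⁻¹ ^ d) * _) := by gcongr
    _ = _ := by
      rw [← mul_assoc, ← ENNReal.ofReal_mul (Real.rpow_nonneg hL.le d),
        ← Real.mul_rpow hL.le (inv_nonneg.2 hL.le), mul_inv_cancel₀ hL.ne', Real.one_rpow,
        ENNReal.ofReal_one, one_mul]

lemma hausdorffMeasure_real_image_of_dist_eq {g : X → Y} {s : Set X} {L d : ℝ} (hL : 0 < L)
    (hd : 0 ≤ d) (h : ∀ x ∈ s, ∀ y ∈ s, dist (g x) (g y) = L * dist x y) :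
    (Measure.hausdorffMeasure d).real (g '' s) = L ^ d * (Measure.hausdorffMeasure d).real s := by
  rw [measureReal_def, hausdorffMeasure_image_of_dist_eq hL hd h, ENNReal.toReal_mul,
    ENNReal.toReal_ofReal (Real.rpow_nonneg hL.le d), measureReal_def]

end Similarity

/-! ### Hausdorff measure of cylinders, dimension, and density rigidity -/

namespace CloneStructure

section Partition

variable {C : Type*} [MetricSpace C] (S : CloneStructure C)

lemma isPiSystem_cyl : IsPiSystem {Z | ∃ p x, Z = S.cyl p x} := by
  rintro _ ⟨p, x, rfl⟩ _ ⟨q, y, rfl⟩ hne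
  rcases le_total p q with h | h
  · exact ⟨q, y, inter_eq_self_of_subset_right (S.cyl_subset_of_inter_nonempty x y h hne)⟩
  · rw [inter_comm] at hne ⊢
    exact ⟨p, x, inter_eq_self_of_subset_right (S.cyl_subset_of_inter_nonempty y x h hne)⟩

lemma cyl_inter_fiber {p : ℕ} {x z : C} {e : Fin S.m} (hz : z ∈ S.cyl p x)
    (he : S.idx (S.τ^[p] z) = e) :
    S.cyl p x ∩ {y | S.idx (S.τ^[p] y) = e} = S.cyl (p + 1) z := by
  ext y
  rw [mem_cyl_succ', S.cyl_eq_of_mem hz, he]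
  rfl

end Partition

section HausdorffMeasure

variable {C : Type*} [MetricSpace C] [MeasurableSpace C] [BorelSpace C] {S : CloneStructure C}
  {δ : ℝ} {v : Fin S.n → ℝ}

lemma hausdorffMeasure_real_model (hδ : 0 ≤ δ) (p : ℕ) (x : C) :
    (Measure.hausdorffMeasure δ).real (S.model (S.modelIdx (S.τ^[p] x))) =
      S.expansion p x ^ δ * (Measure.hausdorffMeasure δ).real (S.cyl p x) := by
  rw [← S.image_iterate_cyl, hausdorffMeasure_real_image_of_dist_eq (S.expansion_pos p x) hδ
    fun y hy z hz => S.dist_iterate_of_mem hy hz]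

lemma IsConformal.isFiniteMeasure [CompactSpace C] (hv : S.IsConformal δ v) :
    IsFiniteMeasure (Measure.hausdorffMeasure δ : Measure C) := by
  refine ⟨?_⟩
  rw [← S.iUnion_model]
  refine (measure_iUnion_le _).trans_lt ?_
  rw [tsum_fintype]
  exact ENNReal.sum_lt_top.2 fun j _ => (hv.hausdorffMeasure_model_ne_top j).lt_top

lemma IsConformal.hausdorffMeasure_real_model_pos [CompactSpace C] (hv : S.IsConformal δ v)
    (j : Fin S.n) : 0 < (Measure.hausdorffMeasure δ).real (S.model j) :=
  ENNReal.toReal_pos (hv.hausdorffMeasure_model_ne_zero j) (hv.hausdorffMeasure_model_ne_top j)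

lemma IsConformal.hausdorffMeasure_real_cyl_pos [CompactSpace C] (hv : S.IsConformal δ v)
    (p : ℕ) (x : C) : 0 < (Measure.hausdorffMeasure δ).real (S.cyl p x) := by
  have h := hv.hausdorffMeasure_real_model_pos (S.modelIdx (S.τ^[p] x))
  rw [hausdorffMeasure_real_model hv.dim_pos.le] at h
  exact pos_of_mul_pos_right h (Real.rpow_nonneg (S.expansion_pos p x).le δ)

/-- A nonempty open set contains a cylinder, hence has positive and finite `δ`-measure. -/
lemma IsConformal.dimH_eq [CompactSpace C] (hv : S.IsConformal δ v) {U : Set C} (hU : IsOpen U)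
    (hne : U.Nonempty) : dimH U = δ.toNNReal := by
  have := hv.isFiniteMeasure
  obtain ⟨x, hx⟩ := hne
  obtain ⟨ε, hε, hball⟩ := Metric.isOpen_iff.1 hU x hx
  obtain ⟨p, hp⟩ := S.exists_cyl_subset_ball hε
  refine dimH_of_hausdorffMeasure_ne_zero_ne_top ?_ ?_ <;>
    rw [Real.coe_toNNReal _ hv.dim_pos.le]
  · intro h0
    have h1 : (Measure.hausdorffMeasure δ).real (S.cyl p x) = 0 := by
      rw [measureReal_def, measure_mono_null ((hp x).trans hball) h0, ENNReal.toReal_zero]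
    exact (hv.hausdorffMeasure_real_cyl_pos p x).ne' h1
  · exact measure_ne_top _ _

end HausdorffMeasure

section Rigidity

variable {C : Type*} [MetricSpace C] [CompactSpace C] [MeasurableSpace C] [BorelSpace C]
  (S : CloneStructure C)

lemma borel_eq_generateFrom_cyl :
    ‹MeasurableSpace C› = MeasurableSpace.generateFrom {Z | ∃ p x, Z = S.cyl p x} := by
  rw [BorelSpace.measurable_eq (α := C)]
  refine TopologicalSpace.IsTopologicalBasis.borel_eq_generateFrom
    (TopologicalSpace.isTopologicalBasis_of_isOpen_of_nhds ?_ ?_)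
  · rintro _ ⟨p, x, rfl⟩
    exact S.isOpen_cyl p x
  · intro x U hx hU
    obtain ⟨ε, hε, hball⟩ := Metric.isOpen_iff.1 hU x hx
    obtain ⟨p, hp⟩ := S.exists_cyl_subset_ball hε
    exact ⟨_, ⟨p, x, rfl⟩, S.self_mem_cyl p x, (hp x).trans hball⟩

lemma measurableSet_cyl_inter_fiber (p : ℕ) (x : C) (e : Fin S.m) :
    MeasurableSet (S.cyl p x ∩ {y | S.idx (S.τ^[p] y) = e}) := by
  rcases (S.cyl p x ∩ {y | S.idx (S.τ^[p] y) = e}).eq_empty_or_nonempty with h | ⟨z, hz, he⟩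
  · exact h ▸ MeasurableSet.empty
  · rw [S.cyl_inter_fiber hz he]
    exact (S.isOpen_cyl _ _).measurableSet

lemma measureReal_cyl_eq_sum (μ : Measure C) [IsFiniteMeasure μ] (p : ℕ) (x : C) :
    μ.real (S.cyl p x) = ∑ e, μ.real (S.cyl p x ∩ {y | S.idx (S.τ^[p] y) = e}) := by
  rw [← measureReal_biUnion_finset ?_ fun e _ => S.measurableSet_cyl_inter_fiber p x e]
  · congr 1
    ext y
    simp
  · intro e _ e' _ hne
    exact disjoint_left.2 fun y hy hy' => hne (hy.2.symm.trans hy'.2)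

variable {S}

/-- If `ν ≤ c μ` on all subcylinders of the next level and `ν = c μ` on the cylinder itself,
then `ν = c μ` on the subcylinders. -/
lemma measureReal_cyl_succ_eq {μ ν : Measure C} [IsFiniteMeasure μ] [IsFiniteMeasure ν] {c : ℝ}
    {p : ℕ} {x : C} (heq : ν.real (S.cyl p x) = c * μ.real (S.cyl p x))
    (hle : ∀ y ∈ S.cyl p x, ν.real (S.cyl (p + 1) y) ≤ c * μ.real (S.cyl (p + 1) y)) :
    ν.real (S.cyl (p + 1) x) = c * μ.real (S.cyl (p + 1) x) := by
  rw [measureReal_cyl_eq_sum, measureReal_cyl_eq_sum S μ, Finset.mul_sum,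
    Finset.sum_eq_sum_iff_of_le] at heq
  · have := heq (S.idx (S.τ^[p] x)) (Finset.mem_univ _)
    rwa [S.cyl_inter_fiber (S.self_mem_cyl p x) rfl] at this
  · intro e _
    rcases (S.cyl p x ∩ {y | S.idx (S.τ^[p] y) = e}).eq_empty_or_nonempty with h | ⟨z, hz, he⟩
    · simp [h]
    · rw [S.cyl_inter_fiber hz he]
      exact hle z hz

/-- Cylinders are nested or disjoint and form a basis, so they are a π-system generating the Borel
sets. -/
lemma restrict_cyl_eq {μ ν : Measure C} [IsFiniteMeasure μ] [IsFiniteMeasure ν] {c : ℝ≥0}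
    {p : ℕ} {x : C} (h : ∀ q, p ≤ q → ∀ y ∈ S.cyl p x,
      ν.real (S.cyl q y) = c * μ.real (S.cyl q y)) :
    ν.restrict (S.cyl p x) = (c • μ).restrict (S.cyl p x) := by
  have key : ∀ q, p ≤ q → ∀ y ∈ S.cyl p x, ν (S.cyl q y) = (c • μ) (S.cyl q y) := by
    intro q hq y hy
    rw [← ENNReal.toReal_eq_toReal_iff' (measure_ne_top _ _) (measure_ne_top _ _)]
    have := h q hq y hy
    rw [measureReal_def, measureReal_def] at this
    rw [this, Measure.smul_apply, ENNReal.smul_def, smul_eq_mul, ENNReal.toReal_mul,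
      ENNReal.coe_toReal]
  have hx := key p le_rfl x (S.self_mem_cyl p x)
  refine ext_of_generate_finite _ S.borel_eq_generateFrom_cyl S.isPiSystem_cyl ?_ ?_
  · rintro _ ⟨q, y, rfl⟩
    have hmeas := (S.isOpen_cyl q y).measurableSet
    rw [Measure.restrict_apply hmeas, Measure.restrict_apply hmeas]
    rcases (S.cyl q y ∩ S.cyl p x).eq_empty_or_nonempty with h0 | hne
    · simp [h0]
    rcases le_total p q with hpq | hpq
    · rw [inter_comm] at hne
      have hsub := S.cyl_subset_of_inter_nonempty x y hpq hne
      rw [inter_eq_self_of_subset_left hsub]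
      exact key q hpq y (hsub (S.self_mem_cyl q y))
    · rwa [inter_eq_self_of_subset_right (S.cyl_subset_of_inter_nonempty y x hpq hne)]
  · simpa using hx

/-- If the density of `ν` with respect to `μ` on cylinders is bounded and changes from a cylinder
to a subcylinder of the next level by one of finitely many factors, then it is constant on the
subcylinders of some cylinder. -/
lemma exists_restrict_cyl_eq [Nonempty C] {μ ν : Measure C} [IsFiniteMeasure μ]
    [IsFiniteMeasure ν] (hμ : ∀ p x, 0 < μ.real (S.cyl p x)) (hν : ∀ p x, 0 < ν.real (S.cyl p x))
    {b : ℝ} (hb : ∀ p x, ν.real (S.cyl p x) ≤ b * μ.real (S.cyl p x)) {R : Set ℝ}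
    (hR : R.Finite) {p₀ : ℕ} (hratio : ∀ p, p₀ ≤ p → ∀ x,
      (ν.real (S.cyl (p + 1) x) / μ.real (S.cyl (p + 1) x)) /
        (ν.real (S.cyl p x) / μ.real (S.cyl p x)) ∈ R) :
    ∃ (c : ℝ≥0) (p : ℕ) (x : C), 0 < c ∧
      ν.restrict (S.cyl p x) = (c • μ).restrict (S.cyl p x) := by
  set r : ℕ → C → ℝ := fun p x => ν.real (S.cyl p x) / μ.real (S.cyl p x) with hr
  have hr0 : ∀ p x, 0 < r p x := fun p x => div_pos (hν p x) (hμ p x)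
  -- By finiteness of `R`, any increase of the density is by a factor at least `η > 1`.
  obtain ⟨η, hη, hRη⟩ : ∃ η : ℝ, 1 < η ∧ ∀ q ∈ R, 1 < q → η ≤ q := by
    rcases (R ∩ Ioi 1).eq_empty_or_nonempty with h | h
    · refine ⟨2, one_lt_two, fun q hq hq1 => ?_⟩
      exact absurd (show q ∈ R ∩ Ioi 1 from ⟨hq, hq1⟩) (by simp [h])
    · obtain ⟨η, hη, hmin⟩ := (hR.inter_of_left (Ioi 1)).exists_minimalFor id _ h
      refine ⟨η, hη.2, fun q hq hq1 => ?_⟩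
      by_contra hlt
      exact hlt (hmin ⟨hq, hq1⟩ (not_le.1 hlt).le)
  obtain ⟨x₀⟩ := ‹Nonempty C›
  set T : Set ℝ := {t | ∃ p, p₀ ≤ p ∧ ∃ x, t = r p x} with hT
  have hTne : T.Nonempty := ⟨_, p₀, le_rfl, x₀, rfl⟩
  have hTb : BddAbove T := by
    refine ⟨b, ?_⟩
    rintro _ ⟨p, -, x, rfl⟩
    exact (div_le_iff₀ (hμ p x)).2 (hb p x)
  have hle : ∀ p, p₀ ≤ p → ∀ x, r p x ≤ sSup T := fun p hp x => le_csSup hTb ⟨p, hp, x, rfl⟩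
  have hs0 : 0 < sSup T := (hr0 p₀ x₀).trans_le (hle _ le_rfl _)
  -- Within a factor `η` of the supremum, an increase would overshoot it.
  obtain ⟨_, ⟨p, hp, x, rfl⟩, hpx⟩ := exists_lt_of_lt_csSup hTne (div_lt_self hs0 hη)
  rw [div_lt_iff₀ (zero_lt_one.trans hη)] at hpx
  refine ⟨⟨r p x, (hr0 p x).le⟩, p, x, hr0 p x, restrict_cyl_eq fun q hq => ?_⟩
  induction q, hq using Nat.le_induction with
  | base =>
    intro y hy
    rw [S.cyl_eq_of_mem hy]
    exact (div_mul_cancel₀ _ (hμ p x).ne').symm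
  | succ q hq ih =>
    intro y hy
    refine measureReal_cyl_succ_eq (ih y hy) fun z hz => ?_
    have hz' : z ∈ S.cyl p x := S.cyl_eq_of_mem hy ▸ S.cyl_antitone y hq hz
    have hrz : r q z = r p x := by
      simp only [hr]
      rw [div_eq_iff (hμ q z).ne']
      exact ih z hz'
    rw [← div_le_iff₀ (hμ _ _)]
    change r (q + 1) z ≤ r p x
    by_contra hlt
    have h1 := hRη _ (hratio q (hp.trans hq) z) ((one_lt_div (hr0 q z)).2 (hrz ▸ not_le.1 hlt))
    rw [le_div_iff₀ (hr0 q z)] at h1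
    have h2 := hle (q + 1) (by omega) z
    change η * r q z ≤ r (q + 1) z at h1
    rw [hrz] at h1
    linarith

end Rigidity

end CloneStructure

/-! ### Bilipschitz images of cylinders -/

namespace IsBilipschitz

section

variable {X Y : Type*} [MetricSpace X] [MetricSpace Y] {K : ℝ} {f : X → Y}

lemma lipschitzWith (hf : IsBilipschitz K f) : LipschitzWith K.toNNReal f :=
  LipschitzWith.of_dist_le_mul fun x y => by
    rw [Real.coe_toNNReal _ hf.1.le]
    exact (hf.2 x y).2

lemma dist_le (hf : IsBilipschitz K f) (x y : X) : dist x y ≤ K * dist (f x) (f y) := by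
  have h := (hf.2 x y).1
  rwa [one_div, inv_mul_le_iff₀ hf.1] at h

lemma antilipschitzWith (hf : IsBilipschitz K f) : AntilipschitzWith K.toNNReal f :=
  AntilipschitzWith.of_le_mul_dist fun x y => by
    rw [Real.coe_toNNReal _ hf.1.le]
    exact hf.dist_le x y

lemma dimH_range (hf : IsBilipschitz K f) : dimH (range f) = dimH (univ : Set X) := by
  rw [← image_univ]
  exact le_antisymm (hf.lipschitzWith.dimH_image_le _) (hf.antilipschitzWith.le_dimH_image _)

variable [MeasurableSpace X] [BorelSpace X] [MeasurableSpace Y] [BorelSpace Y] {δ : ℝ}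

lemma hausdorffMeasure_real_image_le [IsFiniteMeasure (Measure.hausdorffMeasure δ : Measure X)]
    (hf : IsBilipschitz K f) (hδ : 0 ≤ δ) (s : Set X) :
    (Measure.hausdorffMeasure δ).real (f '' s) ≤
      K ^ δ * (Measure.hausdorffMeasure δ).real s := by
  have h := ENNReal.toReal_mono
    (ENNReal.mul_ne_top (ENNReal.rpow_ne_top_of_nonneg hδ ENNReal.coe_ne_top) (measure_ne_top _ _))
    (hf.lipschitzWith.hausdorffMeasure_image_le hδ s)
  rwa [ENNReal.toReal_mul, ← ENNReal.toReal_rpow, ENNReal.coe_toReal,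
    Real.coe_toNNReal _ hf.1.le] at h

lemma hausdorffMeasure_real_le [IsFiniteMeasure (Measure.hausdorffMeasure δ : Measure Y)]
    (hf : IsBilipschitz K f) (hδ : 0 ≤ δ) (s : Set X) :
    (Measure.hausdorffMeasure δ).real s ≤
      K ^ δ * (Measure.hausdorffMeasure δ).real (f '' s) := by
  have h := ENNReal.toReal_mono
    (ENNReal.mul_ne_top (ENNReal.rpow_ne_top_of_nonneg hδ ENNReal.coe_ne_top) (measure_ne_top _ _))
    (hf.antilipschitzWith.le_hausdorffMeasure_image hδ s)
  rwa [ENNReal.toReal_mul, ← ENNReal.toReal_rpow, ENNReal.coe_toReal,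
    Real.coe_toNNReal _ hf.1.le] at h

end

variable {C C' : Type*} [MetricSpace C] [MetricSpace C'] [CompactSpace C']
  {K : ℝ} {f : C → C'}

/-- The image of a cylinder has distance from its complement at least comparable to its size. -/
lemma exists_le_dist_of_mem_image_cyl [CompactSpace C] (S : CloneStructure C)
    (hf : IsBilipschitz K f) (hclopen : IsClopen (range f)) :
    ∃ c : ℝ, 0 < c ∧ ∀ p x, ∀ y ∈ f '' S.cyl p x, ∀ y' ∉ f '' S.cyl p x,
      c ≤ S.expansion p x * dist y y' := by
  obtain ⟨ρ, hρ⟩ := S.exists_separated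
  have hK := hf.1
  have hρ0 := hρ.1
  obtain ⟨ε, hε, hthick⟩ := hclopen.isClosed.isCompact.exists_thickening_subset_open
    hclopen.isOpen Subset.rfl
  -- `ρ / K` handles points of the image; `ε`, a gap between the clopen image and its complement,
  -- handles the others.
  refine ⟨min ε (ρ / K), lt_min hε (by positivity), ?_⟩
  rintro p x _ ⟨z, hz, rfl⟩ y' hy'
  by_cases hr : y' ∈ range f
  · obtain ⟨z', rfl⟩ := hr
    have hz' : z' ∉ S.cyl p z := fun h => hy' ⟨z', S.cyl_eq_of_mem hz ▸ h, rfl⟩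
    refine (min_le_right _ _).trans ?_
    rw [div_le_iff₀ hK, ← S.expansion_eq_of_mem hz, mul_assoc, mul_comm _ K]
    refine (hρ.le_of_notMem hz').trans ?_
    have := S.expansion_pos p z
    have := hf.dist_le z z'
    gcongr
  · refine (min_le_left _ _).trans ?_
    refine le_trans ?_ (le_mul_of_one_le_left dist_nonneg (S.one_le_expansion p x))
    by_contra hlt
    refine hr (hthick (Metric.mem_thickening_iff.2 ⟨f z, mem_range_self z, ?_⟩))
    rw [dist_comm]
    exact not_le.1 hlt

/-- The image of a cylinder lies in a cylinder of comparable size, in which it is a union of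
cylinders of bounded relative level. -/
lemma exists_image_cyl_saturated [CompactSpace C] (S : CloneStructure C) (S' : CloneStructure C')
    (hf : IsBilipschitz K f) (hclopen : IsClopen (range f)) :
    ∃ (c : ℝ) (q : ℕ), 0 < c ∧ ∀ n x p, S'.expansion p (f x) < c * S.expansion n x →
      c * S.expansion n x ≤ S'.expansion (p + 1) (f x) →
      f '' S.cyl n x ⊆ S'.cyl p (f x) ∧
        ∀ w ∈ S'.τ^[p] '' (f '' S.cyl n x), S'.cyl q w ⊆ S'.τ^[p] '' (f '' S.cyl n x) := by
  have hK := hf.1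
  obtain ⟨ρ, hρ⟩ := S'.exists_separated
  have hρ0 := hρ.1
  obtain ⟨D, hD, hdist⟩ := CloneStructure.exists_dist_le (C := C)
  obtain ⟨D', hD', hdist'⟩ := CloneStructure.exists_dist_le (C := C')
  obtain ⟨a, b, ha, hab⟩ := S'.exists_scale_bounds
  obtain ⟨c₂, hc₂, hsep⟩ := hf.exists_le_dist_of_mem_image_cyl S hclopen
  -- The image has diameter at most `K * D / expansion n x`; this `c` makes leaving the level-`p`
  -- cylinder impossible.
  set c := ρ / (K * D) with hc
  have hc0 : 0 < c := by positivity
  -- At relative level `q`, cylinders are smaller than the gap around the image, so one that meets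
  -- it lies inside it.
  obtain ⟨q, hq⟩ := S'.exists_expansion_gt (D' * b / (c * c₂))
  refine ⟨c, q, hc0, fun n x p hlt hle => ?_⟩
  have hE := S.expansion_pos n x
  have hE' := S'.expansion_pos p (f x)
  have hsub : f '' S.cyl n x ⊆ S'.cyl p (f x) := by
    rintro _ ⟨y, hy, rfl⟩
    by_contra hn
    have h1 := hρ.le_of_notMem hn
    have h2 := (hf.2 x y).2
    have h3 := S.dist_le_of_mem_cyl hdist hy
    have h4 : ρ ≤ S'.expansion p (f x) * (K * (D / S.expansion n x)) := by
      refine h1.trans ?_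
      have := h2.trans (mul_le_mul_of_nonneg_left h3 hK.le)
      gcongr
    have h5 : c * S.expansion n x ≤ S'.expansion p (f x) := by
      rw [hc, div_mul_eq_mul_div, div_le_iff₀ (by positivity)]
      calc ρ * S.expansion n x ≤
            S'.expansion p (f x) * (K * (D / S.expansion n x)) * S.expansion n x := by gcongr
        _ = _ := by field_simp
    exact absurd hlt (not_lt.2 h5)
  refine ⟨hsub, ?_⟩
  rintro _ ⟨y, hy, rfl⟩ w hw
  have hmod : S'.modelIdx w = S'.modelIdx (S'.τ^[p] y) := S'.cyl_antitone _ (Nat.zero_le q) hw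
  obtain ⟨y', hy', rfl⟩ := S'.exists_mem_cyl_iterate_eq hmod
  refine ⟨y', ?_, rfl⟩
  by_contra hn
  have h1 := hsep n x y hy y' hn
  have h2 := S'.dist_le_of_mem_cyl hdist' (S'.mem_cyl_add.2 ⟨hy', hw⟩)
  rw [S'.expansion_add, S'.expansion_eq_of_mem (hsub hy)] at h2
  have hq' := hq (S'.τ^[p] y)
  have hEq := S'.expansion_pos q (S'.τ^[p] y)
  have hb : 0 < b := (S'.scale_pos (S'.idx (f x))).trans_le (hab _).2
  have h3 : c * S.expansion n x ≤ S'.expansion p (f x) * b := by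
    refine hle.trans ?_
    rw [S'.expansion_succ']
    have := (hab (S'.idx (S'.τ^[p] (f x)))).2
    gcongr
  rw [div_lt_iff₀ (by positivity)] at hq'
  rw [le_div_iff₀ (by positivity)] at h2
  have h4 : c₂ * (S'.expansion p (f x) * S'.expansion q (S'.τ^[p] y)) ≤
      S.expansion n x * D' := by
    calc _ ≤ S.expansion n x * dist y y' *
          (S'.expansion p (f x) * S'.expansion q (S'.τ^[p] y)) := by gcongr
      _ = S.expansion n x *
          (dist y y' * (S'.expansion p (f x) * S'.expansion q (S'.τ^[p] y))) := by ring
      _ ≤ _ := by gcongr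
  have h5 : c * (S.expansion n x * D') ≤ S'.expansion p (f x) * (D' * b) := by
    calc _ = c * S.expansion n x * D' := by ring
      _ ≤ S'.expansion p (f x) * b * D' := by gcongr
      _ = _ := by ring
  have h6 : S'.expansion p (f x) * (D' * b) <
      S'.expansion p (f x) * (S'.expansion q (S'.τ^[p] y) * (c * c₂)) := by gcongr
  have h7 := mul_le_mul_of_nonneg_left h4 hc0.le
  nlinarith

variable [MeasurableSpace C] [BorelSpace C] [MeasurableSpace C'] [BorelSpace C'] {δ : ℝ}

/-- The density of the image measure on cylinders changes from a cylinder to a subcylinder of the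
next level by one of finitely many factors. -/
lemma exists_finite_ratio [CompactSpace C] (S : CloneStructure C) (S' : CloneStructure C')
    (hδ : 0 ≤ δ) (hf : IsBilipschitz K f) (hclopen : IsClopen (range f)) :
    ∃ R : Set ℝ, R.Finite ∧ ∃ n₀, ∀ n, n₀ ≤ n → ∀ x,
      ((Measure.hausdorffMeasure δ).real (f '' S.cyl (n + 1) x) /
          (Measure.hausdorffMeasure δ).real (S.cyl (n + 1) x)) /
        ((Measure.hausdorffMeasure δ).real (f '' S.cyl n x) /
          (Measure.hausdorffMeasure δ).real (S.cyl n x)) ∈ R := by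
  obtain ⟨c, q, hc, hsat⟩ := hf.exists_image_cyl_saturated S S' hclopen
  obtain ⟨a, b, ha, hab⟩ := S.exists_scale_bounds
  obtain ⟨a', b', ha', hab'⟩ := S'.exists_scale_bounds
  -- One level down in `C` costs a factor at most `b`, and each `p` is fixed up to a factor `b'`, so
  -- the level in `C'` rises by less than `N`.
  obtain ⟨N, hN⟩ := pow_unbounded_of_one_lt (b * b') ha'
  -- From this level on `c * expansion n x > 1`, so a matching level `p` exists in `C'`.
  obtain ⟨n₀, hn₀⟩ := S.exists_expansion_gt c⁻¹
  set V : Set ℝ := (Measure.hausdorffMeasure δ).real '' {U | ∀ x ∈ U, S'.cyl q x ⊆ U}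
  set H : Set ℝ := range fun j => (Measure.hausdorffMeasure δ).real (S.model j)
  set E : Set ℝ := ⋃ i ∈ Finset.range N, range (S'.expansion i)
  have hV : V.Finite := (S'.finite_saturated q).image _
  have hH : H.Finite := finite_range _
  have hE : E.Finite := (Finset.range N).finite_toSet.biUnion fun i _ => S'.finite_range_expansion i
  refine ⟨(fun t : ((ℝ × ℝ) × (ℝ × ℝ)) × (ℝ × ℝ) =>
      (t.1.1.1 / t.1.1.2) / (t.1.2.1 / t.1.2.2) * (t.2.1 ^ δ / t.2.2 ^ δ)) ''
        (((V ×ˢ H) ×ˢ (V ×ˢ H)) ×ˢ (range S.scale ×ˢ E)),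
    (((hV.prod hH).prod (hV.prod hH)).prod ((finite_range _).prod hE)).image _, n₀,
    fun n hn x => ?_⟩
  have hT : ∀ n, n₀ ≤ n → 1 < c * S.expansion n x := fun n hn => by
    rw [← inv_lt_iff_one_lt_mul₀' hc]
    exact (hn₀ x).trans_le ((S.expansion_strictMono x).monotone hn)
  obtain ⟨p, hp, hp'⟩ := S'.exists_expansion_lt_le (hT n hn) (f x)
  obtain ⟨p₂, hp₂, hp₂'⟩ := S'.exists_expansion_lt_le (hT (n + 1) (by omega)) (f x)
  -- The rescaled measure of the image is that of one of finitely many saturated sets.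
  have hvalue : ∀ n p, S'.expansion p (f x) < c * S.expansion n x →
      c * S.expansion n x ≤ S'.expansion (p + 1) (f x) →
      S'.expansion p (f x) ^ δ * (Measure.hausdorffMeasure δ).real (f '' S.cyl n x) ∈ V := by
    intro n p h h'
    obtain ⟨hsub, hs⟩ := hsat n x p h h'
    refine ⟨_, hs, ?_⟩
    exact hausdorffMeasure_real_image_of_dist_eq (S'.expansion_pos _ _) hδ
      fun y hy z hz => S'.dist_iterate_of_mem (hsub hy) (hsub hz)
  have hlt := S.expansion_lt_succ n x
  obtain ⟨i, rfl⟩ : ∃ i, p₂ = p + i := by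
    refine Nat.exists_eq_add_of_le (Nat.lt_succ_iff.1 ?_)
    refine (S'.expansion_strictMono (f x)).lt_iff_lt.1 ?_
    exact hp.trans ((mul_lt_mul_of_pos_left hlt hc).trans_le hp₂')
  set y := S'.τ^[p] (f x)
  have hadd : S'.expansion (p + i) (f x) = S'.expansion p (f x) * S'.expansion i y :=
    S'.expansion_add p i (f x)
  have hp0 := S'.expansion_pos p (f x)
  have hn0 := S.expansion_pos n x
  have hk0 := S.scale_pos (S.idx (S.τ^[n] x))
  have hi0 := S'.expansion_pos i y
  have hi : i < N := by
    have h1 : (a' ^ i) ≤ S'.expansion i y :=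
      S'.pow_le_expansion (zero_le_one.trans ha'.le) (fun e => (hab' e).1) i y
    have h2 : S'.expansion p (f x) * S'.expansion i y < S'.expansion p (f x) * (b * b') := by
      rw [← hadd]
      refine hp₂.trans_le ?_
      rw [S.expansion_succ']
      calc c * (S.expansion n x * S.scale (S.idx (S.τ^[n] x)))
          = c * S.expansion n x * S.scale (S.idx (S.τ^[n] x)) := by ring
        _ ≤ (S'.expansion p (f x) * b') * b := by
            rw [S'.expansion_succ'] at hp'
            have h3 := (hab (S.idx (S.τ^[n] x))).2
            have h4 := (hab' (S'.idx y)).2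
            have h5 := (S'.scale_pos (S'.idx y)).le.trans h4
            refine mul_le_mul (hp'.trans ?_) h3 hk0.le (by positivity)
            gcongr
        _ = _ := by ring
    refine (pow_lt_pow_iff_right₀ ha').1 ?_
    exact h1.trans_lt ((lt_of_mul_lt_mul_left h2 hp0.le).trans hN)
  have hmodel : ∀ z, (Measure.hausdorffMeasure δ).real (S.model (S.modelIdx z)) ∈ H :=
    fun z => ⟨_, rfl⟩
  have hyE : S'.expansion i y ∈ E :=
    mem_biUnion (Finset.mem_coe.2 (Finset.mem_range.2 hi)) ⟨y, rfl⟩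
  have hkS : S.scale (S.idx (S.τ^[n] x)) ∈ range S.scale := ⟨_, rfl⟩
  refine ⟨_, mk_mem_prod (mk_mem_prod
    (mk_mem_prod (hvalue _ _ hp₂ hp₂') (hmodel (S.τ^[n + 1] x)))
    (mk_mem_prod (hvalue _ _ hp hp') (hmodel (S.τ^[n] x)))) (mk_mem_prod hkS hyE), ?_⟩
  dsimp only
  rw [CloneStructure.hausdorffMeasure_real_model hδ, CloneStructure.hausdorffMeasure_real_model hδ,
    hadd, S.expansion_succ', Real.mul_rpow hp0.le hi0.le, Real.mul_rpow hn0.le hk0.le]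
  have h1 := (Real.rpow_pos_of_pos hp0 δ).ne'
  have h2 := (Real.rpow_pos_of_pos hn0 δ).ne'
  have h3 := (Real.rpow_pos_of_pos hk0 δ).ne'
  have h4 := (Real.rpow_pos_of_pos hi0 δ).ne'
  generalize S'.expansion p (f x) ^ δ = A at *
  generalize S.expansion n x ^ δ = B at *
  generalize S.scale (S.idx (S.τ^[n] x)) ^ δ = k at *
  generalize S'.expansion i y ^ δ = l at *
  field_simp

end IsBilipschitz

/-! ### The main theorem -/

theorem mainTheorem3 {C C' : Type*}
    [MetricSpace C] [MeasurableSpace C] [BorelSpace C]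
    [MetricSpace C'] [MeasurableSpace C'] [BorelSpace C']
    (hC : IsMultiModelCantorSet C) (hC' : IsMultiModelCantorSet C')
    (K : ℝ) (f : C → C') (hf : IsBilipschitz K f) (hclopen : IsClopen (Set.range f)) :
    ∃ δ : ℝ≥0, dimH (Set.univ : Set C) = δ ∧ dimH (Set.univ : Set C') = δ ∧
      ∃ A : Set C, IsClopen A ∧ A.Nonempty ∧
        IsMeasureLinearOn (Measure.hausdorffMeasure (δ : ℝ) : Measure C)
          (Measure.hausdorffMeasure (δ : ℝ) : Measure C') f A := by
  have := hC.compact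
  have := hC'.compact
  have := hC.nonempty
  have := hC'.nonempty
  obtain ⟨S, hS⟩ := hC.exists_cloneStructure
  obtain ⟨S', hS'⟩ := hC'.exists_cloneStructure
  obtain ⟨δ, v, hv⟩ := hS.exists_isConformal
  obtain ⟨δ', v', hv'⟩ := hS'.exists_isConformal
  have hdim := hv.dimH_eq isOpen_univ univ_nonempty
  have hdim' := hv'.dimH_eq isOpen_univ univ_nonempty
  -- The image has dimension `δ'` as an open set and `δ` as a bilipschitz copy of `C`.
  have hrange := hv'.dimH_eq hclopen.isOpen (range_nonempty f)
  rw [hf.dimH_range, hdim, ENNReal.coe_inj,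
    Real.toNNReal_eq_toNNReal_iff hv.dim_pos.le hv'.dim_pos.le] at hrange
  subst hrange
  refine ⟨δ.toNNReal, hdim, hdim', ?_⟩
  rw [Real.coe_toNNReal _ hv.dim_pos.le]
  have := hv.isFiniteMeasure
  have := hv'.isFiniteMeasure
  have hδ := hv.dim_pos.le
  have hemb : MeasurableEmbedding f :=
    (hf.lipschitzWith.continuous.isClosedEmbedding
      hf.antilipschitzWith.injective).measurableEmbedding
  set μ : Measure C := Measure.hausdorffMeasure δ
  set ν : Measure C := (Measure.hausdorffMeasure δ : Measure C').comap f with hν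
  have hνapply : ∀ B, ν B = Measure.hausdorffMeasure δ (f '' B) := hemb.comap_apply _
  have hνreal : ∀ B, ν.real B = (Measure.hausdorffMeasure δ).real (f '' B) := fun B => by
    rw [measureReal_def, hνapply, measureReal_def]
  have hνfin : IsFiniteMeasure ν := ⟨by rw [hνapply]; exact measure_lt_top _ _⟩
  obtain ⟨R, hR, n₀, hratio⟩ := hf.exists_finite_ratio S S' hδ hclopen
  obtain ⟨c, p, x, hc, heq⟩ := CloneStructure.exists_restrict_cyl_eq (S := S) (μ := μ) (ν := ν)
    hv.hausdorffMeasure_real_cyl_pos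
    (fun p x => by
      rw [hνreal]
      exact pos_of_mul_pos_right ((hv.hausdorffMeasure_real_cyl_pos p x).trans_le
        (hf.hausdorffMeasure_real_le hδ _)) (Real.rpow_nonneg hf.1.le δ))
    (fun p x => by
      rw [hνreal]
      exact hf.hausdorffMeasure_real_image_le hδ _)
    hR (fun n hn x => by
      rw [hνreal, hνreal]
      exact hratio n hn x)
  refine ⟨S.cyl p x, S.isClopen_cyl p x, ⟨x, S.self_mem_cyl p x⟩, c, hc, fun B hB hBm => ?_⟩
  have h := congrArg (fun m : Measure C => m B) heq
  simp only [Measure.restrict_apply hBm, inter_eq_self_of_subset_left hB, hνapply] at h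
  rw [h]
  rfl
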